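/- There is a deterministic logspace algorithm that computes a minimal path decomposition of every directed acyclic graph. In detail, a path decomposition of a finite digraph $G$ (without loops or multiple arcs) is a finite family of simple directed paths in $G$ such that every edge of $G$ lies on exactly one path of the family, and it is minimal if no path decomposition of $G$ has fewer paths. There are a deterministic Turing machine $M$ with a read-only input tape, finitely many work tapes and a write-only output tape, and a constant $C$, such that for every $n \ge 0$ and every acyclic digraph $G$ on the vertex set $\{0,\dots,n-1\}$, the machine $M$, given the adjacency matrix of $G$, uses at most $C(\lfloor \log_2 n\rfloor + 1)$ cells of each work tape (at most $C$ cells if $n = 0$) and halts with the list of the paths of a minimal path decomposition $P$ of $G$ as its output, each path written as the sequence of its vertices in binary. Moreover, with $d^+(v)$ and $d^-(v)$ the outdegree and the indegree of $v$ in $G$, the number of paths in $P$ is $$|P| = \sum_{v} \max\bigl(0,\, d^+(v) - d^-(v)\bigr).$$ -/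

import Mathlib

/-! ### Logarithmic space: Turing machines with a read-only input and a write-only output -/

/-- A move of a tape head by one cell to the left, not at all, or by one cell to the right. -/
inductive HeadMove where
  | left
  | stay
  | right

/-- The content of a cell of the input tape: an input symbol, or one of the two end markers that
enclose the input word. -/
inductive InputCell (α : Type) where
  | leftEnd
  | symbol (a : α)
  | rightEnd

/-- What a machine does in one step: the next state, the symbols written on the work tapes, the
moves of the input head and of the work heads, and at most one symbol appended to the output. -/
structure TransducerAction (State Γ β : Type) (k : ℕ) where
  next : State
  write : Fin k → Γ
  inputMove : HeadMove
  workMove : Fin k → HeadMove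
  emit : Option β

/-- A deterministic Turing machine transducer with a two-way read-only input tape over the
alphabet `α`, finitely many read-write work tapes (infinite to the right) over a finite alphabet,
and a one-way write-only output tape over the alphabet `β`. The transition function sees the
state, the scanned input cell and the scanned work symbols; the value `none` means halting. -/
structure Transducer (α β : Type) where
  /-- the number of work tapes -/
  k : ℕ
  State : Type
  finite_state : Finite State
  /-- the work alphabet -/
  Γ : Type
  finite_alphabet : Finite Γ
  blank : Γ
  start : State
  δ : State → InputCell α → (Fin k → Γ) → Option (TransducerAction State Γ β k)

namespace Transducer

variable {α β : Type}

/-- A configuration: state, position of the input head, contents of the work tapes, positions of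
the work heads, and the output written so far. -/
structure Config (M : Transducer α β) where
  state : M.State
  inputHead : ℕ
  tape : Fin M.k → ℕ → M.Γ
  head : Fin M.k → ℕ
  output : List β

/-- The input tape: cell `0` holds the left end marker, the cells `1, …, x.length` hold the word
`x`, and cell `x.length + 1` holds the right end marker. -/
def inputCell (x : List α) : ℕ → InputCell α
  | 0 => .leftEnd
  | p + 1 => match x[p]? with
    | some a => .symbol a
    | none => .rightEnd

/-- Moving a head on a tape that is infinite to the right; at cell `0` a left move has no
effect. -/
def moveHead : HeadMove → ℕ → ℕ
  | .left, p => p - 1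
  | .stay, p => p
  | .right, p => p + 1

/-- The initial configuration: all work tapes blank, all heads on cell `0`, empty output. -/
def init (M : Transducer α β) : M.Config where
  state := M.start
  inputHead := 0
  tape := fun _ _ => M.blank
  head := fun _ => 0
  output := []

/-- One step on input `x`; `none` if the machine halts. The input head cannot move beyond the
right end marker. -/
def step (M : Transducer α β) (x : List α) (c : M.Config) : Option M.Config :=
  (M.δ c.state (inputCell x c.inputHead) (fun i => c.tape i (c.head i))).map fun a =>
    { state := a.next
      inputHead := min (moveHead a.inputMove c.inputHead) (x.length + 1)
      tape := fun i => Function.update (c.tape i) (c.head i) (a.write i)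
      head := fun i => moveHead (a.workMove i) (c.head i)
      output := c.output ++ a.emit.toList }

/-- On input `x` the machine halts with output `y`, and during the whole computation every work
head scans only the first `s` cells of its tape. (The number of tapes is fixed with the machine;
the input and output tapes are not charged.) -/
def ComputesInSpace (M : Transducer α β) (x : List α) (y : List β) (s : ℕ) : Prop :=
  (∃ c : M.Config, StateTransition.Reaches (M.step x) M.init c ∧ M.step x c = none ∧
    c.output = y) ∧
  ∀ c : M.Config, StateTransition.Reaches (M.step x) M.init c → ∀ i, c.head i < s

end Transducer

/-! ### Path decompositions of digraphs -/

namespace Digraph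

variable {V : Type*}

/-- A digraph is acyclic if no vertex lies on a directed closed walk (in particular there are no
loops). -/
def IsAcyclic (G : Digraph V) : Prop :=
  ∀ v, ¬ Relation.TransGen G.Adj v v

/-- `d⁺(v)` -/
noncomputable def outdegree (G : Digraph V) (v : V) : ℕ := {w | G.Adj v w}.ncard

/-- `d⁻(v)` -/
noncomputable def indegree (G : Digraph V) (v : V) : ℕ := {u | G.Adj u v}.ncard

/-- A simple directed path, given as the nonempty list of its (distinct) vertices. -/
def IsSimplePath (G : Digraph V) (p : List V) : Prop :=
  p ≠ [] ∧ p.IsChain G.Adj ∧ p.Nodup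

/-- A path decomposition: a finite family of simple directed paths such that every edge lies on
exactly one path (with indices, so that a repeated path counts twice). An edge `(u, v)` lies on a
path if `u`, `v` are consecutive vertices of it. -/
def IsPathDecomposition (G : Digraph V) (P : List (List V)) : Prop :=
  (∀ p ∈ P, G.IsSimplePath p) ∧
  ∀ u v, G.Adj u v → ∃! i : Fin P.length, [u, v] <:+: P[i]

/-- A path decomposition with the smallest possible number of paths. -/
def IsMinimalPathDecomposition (G : Digraph V) (P : List (List V)) : Prop :=
  G.IsPathDecomposition P ∧ ∀ Q, G.IsPathDecomposition Q → P.length ≤ Q.length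

end Digraph

/-! ### Encodings of digraphs and of path decompositions as words -/

/-- The input alphabet: bits and an end-of-row symbol. -/
inductive GraphSymbol where
  | bit (b : Bool)
  | endRow

/-- The output alphabet: bits, an end-of-vertex symbol and an end-of-path symbol. -/
inductive PathSymbol where
  | bit (b : Bool)
  | endVertex
  | endPath

open Classical in
/-- The adjacency matrix of a digraph on `{0, …, n - 1}`, row by row. -/
noncomputable def encodeDigraph {n : ℕ} (G : Digraph (Fin n)) : List GraphSymbol :=
  (List.finRange n).flatMap fun u =>
    ((List.finRange n).map fun v => GraphSymbol.bit (decide (G.Adj u v))) ++ [GraphSymbol.endRow]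

/-- The binary numeral of a vertex, most significant bit first (empty for `0`), followed by the
end-of-vertex symbol. -/
def encodeVertex {n : ℕ} (v : Fin n) : List PathSymbol :=
  (Nat.bits v).reverse.map PathSymbol.bit ++ [PathSymbol.endVertex]

/-- The sequence of the paths, each written as the sequence of its vertices followed by the
end-of-path symbol. -/
def encodePaths {n : ℕ} (P : List (List (Fin n))) : List PathSymbol :=
  P.flatMap fun p => p.flatMap encodeVertex ++ [PathSymbol.endPath]

/-! At every vertex `v`, pair the `i`-th in-arc with the `i`-th out-arc in the order of the
vertices, and let an arc be followed by its partner. Since ranks are injective, every arc has at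
most one successor and at most one predecessor (`followedBy_right_unique`,
`followedBy_left_unique`), so the arcs split into chains. Acyclicity makes every chain start at an
arc without predecessor and end, and makes the walk along it a simple path (`exists_isFirst`,
`exists_isTrace`, `nodup_of_isChain`). An out-arc of `v` starts a chain iff its rank is at least
`d⁻(v)`, so `max 0 (d⁺(v) - d⁻(v))` chains start at `v` (`card_isFirst`).

No decomposition does better. The out-arcs of `v` lie on distinct paths, and each of these paths
either starts at `v` or uses an in-arc of `v`; so at least `d⁺(v) - d⁻(v)` paths start at `v`
(`sum_le_length`).

Whether one arc follows another is decided by counting two ranks in the matrix. Hence the chains can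
be written with ten registers holding numbers up to `n`: for each pair `(v, w)`, test that it is an
arc without predecessor, then search for successors until there is none. The machine is composed of
fragments, each with a lemma giving the memory after its run and bounding its space;
`runs_writePaths` is the outcome. -/

/-! ### Machine fragments -/

/-- The part of a configuration of a transducer that does not depend on its set of states. -/
structure Memory (β Γ : Type) (k : ℕ) where
  inputHead : ℕ
  tape : Fin k → ℕ → Γ
  head : Fin k → ℕ
  output : List β

/-- A piece of a transducer that is entered at `start` and left with a truth value. -/
structure Fragment (α β Γ : Type) (k : ℕ) where
  State : Type
  finite_state : Finite State
  start : State
  δ : State → InputCell α → (Fin k → Γ) → TransducerAction State Γ β k ⊕ Bool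

namespace TransducerAction

variable {S S' Γ β : Type} {k : ℕ}

/-- Renaming the next state. -/
def mapNext (f : S → S') (a : TransducerAction S Γ β k) : TransducerAction S' Γ β k where
  next := f a.next
  write := a.write
  inputMove := a.inputMove
  workMove := a.workMove
  emit := a.emit

/-- A change of state that leaves the memory as it is; `w` are the scanned symbols. -/
def idle (q : S) (w : Fin k → Γ) : TransducerAction S Γ β k where
  next := q
  write := w
  inputMove := .stay
  workMove := fun _ => .stay
  emit := none

end TransducerAction

namespace Memory

variable {α β Γ S S' : Type} {k : ℕ}

/-- The initial memory. -/
def init (blank : Γ) : Memory β Γ k where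
  inputHead := 0
  tape := fun _ _ => blank
  head := fun _ => 0
  output := []

/-- The symbols scanned by the work heads. -/
def scan (m : Memory β Γ k) : Fin k → Γ := fun i => m.tape i (m.head i)

/-- The effect of an action on the memory. -/
def apply (x : List α) (m : Memory β Γ k) (a : TransducerAction S Γ β k) : Memory β Γ k where
  inputHead := min (Transducer.moveHead a.inputMove m.inputHead) (x.length + 1)
  tape := fun i => Function.update (m.tape i) (m.head i) (a.write i)
  head := fun i => Transducer.moveHead (a.workMove i) (m.head i)
  output := m.output ++ a.emit.toList

/-- The input head is on the input tape and the work heads are on the first `s` cells. -/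
def InSpace (x : List α) (s : ℕ) (m : Memory β Γ k) : Prop :=
  m.inputHead ≤ x.length + 1 ∧ ∀ i, m.head i < s

/-- An action that stays in place still caps the input head at the right end marker. This is why
`InSpace` also bounds the input head. -/
lemma apply_idle {x : List α} {s : ℕ} {m : Memory β Γ k} (h : m.InSpace x s) (q : S) :
    m.apply x (.idle q m.scan) = m := by
  obtain ⟨p, t, hd, o⟩ := m
  have := h.1
  simp_all [apply, TransducerAction.idle, Transducer.moveHead, scan]

end Memory

namespace Fragment

variable {α β Γ : Type} {k : ℕ}

/-- Started in the state `q` with the memory `m`, the fragment is left with the truth value `b`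
and the memory `m'`, and the work heads stay on the first `s` cells. -/
inductive RunsFrom (F : Fragment α β Γ k) (x : List α) (s : ℕ) :
    F.State → Memory β Γ k → Bool → Memory β Γ k → Prop
  | exit {q m b} : m.InSpace x s → F.δ q (Transducer.inputCell x m.inputHead) m.scan = .inr b →
      RunsFrom F x s q m b m
  | step {q m a b m'} : m.InSpace x s →
      F.δ q (Transducer.inputCell x m.inputHead) m.scan = .inl a →
      RunsFrom F x s a.next (m.apply x a) b m' → RunsFrom F x s q m b m'

/-- A run from the start state. -/
def Runs (F : Fragment α β Γ k) (x : List α) (s : ℕ) (m : Memory β Γ k) (b : Bool)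
    (m' : Memory β Γ k) : Prop :=
  F.RunsFrom x s F.start m b m'

/-- The transducer that halts when the fragment is left. -/
def toTransducer [Finite Γ] (F : Fragment α β Γ k) (blank : Γ) : Transducer α β where
  k := k
  State := F.State
  finite_state := F.finite_state
  Γ := Γ
  finite_alphabet := inferInstance
  blank := blank
  start := F.start
  δ := fun q c w => (F.δ q c w).getLeft?

/-- By determinism, a configuration reachable from the current one is the current one itself or is
reachable from its only successor. So induction on the run yields both halting and the space bound.
-/
lemma RunsFrom.computes [Finite Γ] {F : Fragment α β Γ k} {blank : Γ} {x : List α} {s : ℕ}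
    {q : F.State} {m m' : Memory β Γ k} {b : Bool} (h : F.RunsFrom x s q m b m') :
    (∃ c : (F.toTransducer blank).Config,
      StateTransition.Reaches ((F.toTransducer blank).step x)
        ⟨q, m.inputHead, m.tape, m.head, m.output⟩ c ∧
      (F.toTransducer blank).step x c = none ∧ c.output = m'.output) ∧
    ∀ c : (F.toTransducer blank).Config,
      StateTransition.Reaches ((F.toTransducer blank).step x)
        ⟨q, m.inputHead, m.tape, m.head, m.output⟩ c → ∀ i, c.head i < s := by
  induction h with
  | @exit q m b hm hq =>
    have hn : (F.toTransducer blank).step x ⟨q, m.inputHead, m.tape, m.head, m.output⟩ = none := by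
      simp only [Transducer.step, toTransducer]
      unfold Memory.scan at hq
      simp [hq]
    refine ⟨⟨_, .refl, hn, rfl⟩, fun c hc => ?_⟩
    rcases hc.cases_head with rfl | ⟨c', h1, -⟩
    · exact hm.2
    · rw [hn] at h1
      simp at h1
  | @step q m a b m' hm hq _ ih =>
    have hn : (F.toTransducer blank).step x ⟨q, m.inputHead, m.tape, m.head, m.output⟩ =
        some ⟨a.next, (m.apply x a).inputHead, (m.apply x a).tape, (m.apply x a).head,
          (m.apply x a).output⟩ := by
      simp only [Transducer.step, toTransducer]
      unfold Memory.scan at hq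
      simp [hq, Memory.apply]
    obtain ⟨⟨c, h1, h2, h3⟩, h4⟩ := ih
    refine ⟨⟨c, .head (by rw [hn]; rfl) h1, h2, h3⟩, fun c hc => ?_⟩
    rcases hc.cases_head with rfl | ⟨c', h5, h6⟩
    · exact hm.2
    · rw [hn] at h5
      obtain rfl := Option.some.inj h5
      exact h4 c h6

lemma Runs.computesInSpace [Finite Γ] {F : Fragment α β Γ k} {blank : Γ} {x : List α} {s : ℕ}
    {m' : Memory β Γ k} {b : Bool} (h : F.Runs x s (.init blank) b m') :
    (F.toTransducer blank).ComputesInSpace x m'.output s :=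
  RunsFrom.computes h

/-- The effect on the memory ignores the next state, so a step of a component is a step of the
compound fragment with the state renamed. -/
lemma RunsFrom.step_mapNext {F : Fragment α β Γ k} {x : List α} {s : ℕ} {q : F.State}
    {m m' : Memory β Γ k} {b : Bool} {S : Type} (f : S → F.State) {a : TransducerAction S Γ β k}
    (hm : m.InSpace x s)
    (hq : F.δ q (Transducer.inputCell x m.inputHead) m.scan = .inl (a.mapNext f))
    (h : F.RunsFrom x s (f a.next) (m.apply x a) b m') : F.RunsFrom x s q m b m' :=
  .step hm hq h

lemma RunsFrom.step_idle {F : Fragment α β Γ k} {x : List α} {s : ℕ} {q : F.State}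
    {m m' : Memory β Γ k} {b : Bool} (q' : F.State) (hm : m.InSpace x s)
    (hq : F.δ q (Transducer.inputCell x m.inputHead) m.scan = .inl (.idle q' m.scan))
    (h : F.RunsFrom x s q' m b m') : F.RunsFrom x s q m b m' :=
  .step hm hq (by rwa [Memory.apply_idle hm])

/-! #### Combinators -/

/-- Leave at once, with a truth value that depends on the scanned cells. -/
def test (t : InputCell α → (Fin k → Γ) → Bool) : Fragment α β Γ k where
  State := Unit
  finite_state := inferInstance
  start := ()
  δ := fun _ c w => .inr (t c w)

/-- One step. -/
def act (f : (Fin k → Γ) → TransducerAction Unit Γ β k) : Fragment α β Γ k where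
  State := Bool
  finite_state := inferInstance
  start := false
  δ := fun q _ w => if q then .inr true else .inl ((f w).mapNext fun _ => true)

/-- Run `T` and continue with `A` or `B` according to its truth value. -/
def ite (T A B : Fragment α β Γ k) : Fragment α β Γ k where
  State := T.State ⊕ A.State ⊕ B.State
  finite_state :=
    have := T.finite_state
    have := A.finite_state
    have := B.finite_state
    inferInstance
  start := .inl T.start
  δ := fun q c w => match q with
    | .inl q => match T.δ q c w with
      | .inl a => .inl (a.mapNext .inl)
      | .inr b => .inl (.idle (.inr (if b then .inl A.start else .inr B.start)) w)
    | .inr (.inl q) => (A.δ q c w).map (.mapNext fun q => .inr (.inl q)) id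
    | .inr (.inr q) => (B.δ q c w).map (.mapNext fun q => .inr (.inr q)) id

/-- As long as `T` yields `true`, run `B`. -/
def loop (T B : Fragment α β Γ k) : Fragment α β Γ k where
  State := T.State ⊕ B.State
  finite_state :=
    have := T.finite_state
    have := B.finite_state
    inferInstance
  start := .inl T.start
  δ := fun q c w => match q with
    | .inl q => match T.δ q c w with
      | .inl a => .inl (a.mapNext .inl)
      | .inr true => .inl (.idle (.inr B.start) w)
      | .inr false => .inr true
    | .inr q => match B.δ q c w with
      | .inl a => .inl (a.mapNext .inr)
      | .inr _ => .inl (.idle (.inl T.start) w)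

/-- Leave at once with the truth value `b`. -/
def ret (b : Bool) : Fragment α β Γ k := test fun _ _ => b

/-- Run `A`, then `B`. -/
def seq (A B : Fragment α β Γ k) : Fragment α β Γ k := ite A B B

/-- Run `A` and negate its truth value. -/
def not (A : Fragment α β Γ k) : Fragment α β Γ k := ite A (ret false) (ret true)

/-- The conjunction of two tests, of which the second is run only if the first yields `true`. -/
def and (A B : Fragment α β Γ k) : Fragment α β Γ k := ite A B (ret false)

/-- Run `A` if `T` yields `true`. -/
def when (T A : Fragment α β Γ k) : Fragment α β Γ k := ite T A (ret true)

/-! ### Rules for runs of composed fragments -/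

variable {x : List α} {s : ℕ} {m m₁ m₂ m₃ : Memory β Γ k} {b b' : Bool}
variable {T A B : Fragment α β Γ k}

lemma RunsFrom.inSpace_right {q : A.State} (h : A.RunsFrom x s q m b m₁) : m₁.InSpace x s := by
  induction h with
  | exit hm _ => exact hm
  | step _ _ _ ih => exact ih

lemma Runs.inSpace_right (h : A.Runs x s m b m₁) : m₁.InSpace x s := RunsFrom.inSpace_right h

lemma runs_test (t : InputCell α → (Fin k → Γ) → Bool) (hm : m.InSpace x s) :
    (test t).Runs x s m (t (Transducer.inputCell x m.inputHead) m.scan) m :=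
  .exit hm rfl

lemma runs_ret (hm : m.InSpace x s) : (ret b).Runs x s m b m := runs_test _ hm

lemma runs_act {f : (Fin k → Γ) → TransducerAction Unit Γ β k} (hm : m.InSpace x s)
    (hm' : (m.apply x (f m.scan)).InSpace x s) :
    (act f).Runs x s m true (m.apply x (f m.scan)) :=
  .step (a := (f m.scan).mapNext fun _ => true) hm rfl (.exit hm' rfl)

lemma RunsFrom.ite_left {q : A.State} (h : A.RunsFrom x s q m b m₁) :
    (ite T A B).RunsFrom x s (.inr (.inl q)) m b m₁ := by
  induction h with
  | exit hm hq => exact .exit hm (by simp [ite, hq])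
  | @step q m a b m' hm hq _ ih =>
    exact .step_mapNext (fun q => Sum.inr (Sum.inl q)) hm (by simp [ite, hq]) ih

lemma RunsFrom.ite_right {q : B.State} (h : B.RunsFrom x s q m b m₁) :
    (ite T A B).RunsFrom x s (.inr (.inr q)) m b m₁ := by
  induction h with
  | exit hm hq => exact .exit hm (by simp [ite, hq])
  | @step q m a b m' hm hq _ ih =>
    exact .step_mapNext (fun q => Sum.inr (Sum.inr q)) hm (by simp [ite, hq]) ih

lemma RunsFrom.ite {q : T.State} (h : T.RunsFrom x s q m b m₁)
    (h' : (bif b then A else B).Runs x s m₁ b' m₂) :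
    (ite T A B).RunsFrom x s (.inl q) m b' m₂ := by
  induction h with
  | @exit q m b hm hq =>
    refine .step_idle (Sum.inr (if b then Sum.inl A.start else Sum.inr B.start)) hm
      (by simp [Fragment.ite, hq]) ?_
    cases b
    · exact RunsFrom.ite_right h'
    · exact RunsFrom.ite_left h'
  | @step q m a b m' hm hq _ ih =>
    exact .step_mapNext Sum.inl hm (by simp [Fragment.ite, hq]) (ih h')

lemma Runs.ite_true (h : T.Runs x s m true m₁) (h' : A.Runs x s m₁ b m₂) :
    (ite T A B).Runs x s m b m₂ := RunsFrom.ite h h'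

lemma Runs.ite_false (h : T.Runs x s m false m₁) (h' : B.Runs x s m₁ b m₂) :
    (ite T A B).Runs x s m b m₂ := RunsFrom.ite h h'

lemma Runs.seq (h : A.Runs x s m b m₁) (h' : B.Runs x s m₁ b' m₂) :
    (seq A B).Runs x s m b' m₂ := RunsFrom.ite h (by cases b <;> exact h')

lemma Runs.not (h : A.Runs x s m b m₁) : (not A).Runs x s m (!b) m₁ :=
  RunsFrom.ite h (by cases b <;> exact runs_ret h.inSpace_right)

/-- The guard `b = true` is needed in `search`, where the second test makes sense only for values
below `n`. -/
lemma Runs.and (h : A.Runs x s m b m) (h' : b = true → B.Runs x s m b' m) :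
    (and A B).Runs x s m (b && b') m :=
  RunsFrom.ite h (by
    cases b
    · exact runs_ret h.inSpace_right
    · exact h' rfl)

lemma Runs.when_true (h : T.Runs x s m true m₁) (h' : A.Runs x s m₁ b m₂) :
    (when T A).Runs x s m b m₂ := h.ite_true h'

lemma Runs.when_false (h : T.Runs x s m false m₁) : (when T A).Runs x s m true m₁ :=
  h.ite_false (runs_ret h.inSpace_right)

lemma RunsFrom.loop_body {q : B.State} (h : B.RunsFrom x s q m b m₁)
    (h' : (loop T B).Runs x s m₁ b' m₂) : (loop T B).RunsFrom x s (.inr q) m b' m₂ := by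
  induction h with
  | @exit q m b hm hq =>
    refine .step_idle (Sum.inl T.start) hm (by simp [Fragment.loop, hq]) ?_
    exact h'
  | @step q m a b m' hm hq _ ih =>
    exact .step_mapNext Sum.inr hm (by simp [Fragment.loop, hq]) (ih h')

lemma RunsFrom.loop_true {q : T.State} (h : T.RunsFrom x s q m b m₁) (hb : b = true)
    (h' : (loop T B).RunsFrom x s (.inr B.start) m₁ b' m₂) :
    (loop T B).RunsFrom x s (.inl q) m b' m₂ := by
  induction h with
  | @exit q m b hm hq =>
    subst hb
    refine .step_idle (Sum.inr B.start) hm (by simp [Fragment.loop, hq]) ?_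
    exact h'
  | @step q m a b m' hm hq _ ih =>
    exact .step_mapNext Sum.inl hm (by simp [Fragment.loop, hq]) (ih hb h')

lemma RunsFrom.loop_false {q : T.State} (h : T.RunsFrom x s q m b m₁) (hb : b = false) :
    (loop T B).RunsFrom x s (.inl q) m true m₁ := by
  induction h with
  | @exit q m b hm hq =>
    subst hb
    exact .exit hm (by simp [Fragment.loop, hq])
  | @step q m a b m' hm hq _ ih =>
    exact .step_mapNext Sum.inl hm (by simp [Fragment.loop, hq]) (ih hb)

lemma Runs.loop_true (h : T.Runs x s m true m₁) (h₁ : B.Runs x s m₁ b m₂)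
    (h₂ : (loop T B).Runs x s m₂ b' m₃) : (loop T B).Runs x s m b' m₃ :=
  RunsFrom.loop_true h rfl (RunsFrom.loop_body h₁ h₂)

lemma Runs.loop_false (h : T.Runs x s m false m₁) : (loop T B).Runs x s m true m₁ :=
  RunsFrom.loop_false h rfl

/-- Here `f i` is the memory before pass `i`; the counted loops and the scans to the right are
instances. -/
lemma runs_loop (f : ℕ → Memory β Γ k) (K : ℕ) (hT : ∀ i < K, T.Runs x s (f i) true (f i))
    (hB : ∀ i < K, B.Runs x s (f i) true (f (i + 1))) (hF : T.Runs x s (f K) false (f K)) :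
    (loop T B).Runs x s (f 0) true (f K) := by
  induction K generalizing f with
  | zero => exact hF.loop_false
  | succ K ih =>
    exact (hT 0 K.succ_pos).loop_true (hB 0 K.succ_pos) (ih (fun i => f (i + 1))
      (fun i hi => hT _ (by omega)) (fun i hi => hB _ (by omega)) hF)

end Fragment

/-! ### Binary registers on the work tapes -/

/-- The work alphabet: blank, a mark for cell `0`, and bits. -/
abbrev TapeSymbol : Type := Option (Option Bool)

/-- The tape with the mark on cell `0`, followed by the bits of `l`. -/
def listTape (l : List Bool) : ℕ → TapeSymbol
  | 0 => some none
  | j + 1 => l[j]?.map some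

section listTape

variable (l : List Bool) (a b : Bool)

@[simp] lemma listTape_zero : listTape l 0 = some none := rfl

@[simp] lemma update_listTape_zero : Function.update (listTape l) 0 (some none) = listTape l := by
  simp [Function.update_eq_self_iff]

lemma listTape_succ_ne (j : ℕ) : listTape l (j + 1) ≠ some none := by
  simp only [listTape]
  cases l[j]? <;> simp

@[simp] lemma listTape_length_succ : listTape l (l.length + 1) = none := by simp [listTape]

lemma listTape_append_head (l' : List Bool) :
    listTape (l ++ l') (l.length + 1) = l'.head?.map some := by
  cases l' <;> simp [listTape]

lemma update_listTape_append_cons (l' : List Bool) :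
    Function.update (listTape (l ++ a :: l')) (l.length + 1) (some (some b)) =
      listTape (l ++ b :: l') := by
  funext j
  rcases j with _ | j
  · simp
  · rcases lt_trichotomy j l.length with h | rfl | h
    · rw [Function.update_of_ne (by omega)]
      simp [listTape, List.getElem?_append_left h]
    · simp [listTape]
    · rw [Function.update_of_ne (by omega)]
      obtain ⟨d, rfl⟩ := Nat.exists_eq_add_of_lt h
      simp only [listTape, List.getElem?_append_right (show l.length ≤ l.length + d + 1 by omega),
        show l.length + d + 1 - l.length = d + 1 by omega, List.getElem?_cons_succ]

lemma update_listTape_length :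
    Function.update (listTape l) (l.length + 1) (some (some b)) = listTape (l ++ [b]) := by
  funext j
  rcases j with _ | j
  · simp
  · rcases lt_trichotomy j l.length with h | rfl | h
    · rw [Function.update_of_ne (by omega)]
      simp [listTape, List.getElem?_append_left h]
    · simp [listTape]
    · rw [Function.update_of_ne (by omega)]
      have h1 : l.length ≤ j := h.le
      have h2 : (l ++ [b]).length ≤ j := by simpa using h
      simp only [listTape, List.getElem?_eq_none h1, List.getElem?_eq_none h2]

lemma update_listTape_blank :
    Function.update (listTape (l ++ [b])) (l.length + 1) none = listTape l := by
  rw [← update_listTape_length, Function.update_idem, Function.update_eq_self_iff]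
  simp

end listTape

/-- Adding one to a binary numeral, least significant bit first. -/
def succBits : List Bool → List Bool
  | [] => [true]
  | false :: l => true :: l
  | true :: l => false :: succBits l

lemma bits_succ (n : ℕ) : (n + 1).bits = succBits n.bits := by
  induction n using Nat.binaryRec with
  | zero => simp [succBits]
  | bit b n ih =>
    cases b
    -- The numeral of `0` is empty, so the rule for a low bit `0` needs `n ≠ 0`.
    · rcases Nat.eq_zero_or_pos n with rfl | hn
      · simp [succBits]
      · rw [show Nat.bit false n + 1 = 2 * n + 1 by simp [Nat.bit_val], Nat.bit1_bits,
          show Nat.bit false n = 2 * n by simp [Nat.bit_val], Nat.bit0_bits _ hn.ne']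
        rfl
    · rw [show Nat.bit true n + 1 = 2 * (n + 1) by simp [Nat.bit_val]; ring,
        Nat.bit0_bits _ n.succ_ne_zero, ih, show Nat.bit true n = 2 * n + 1 by simp [Nat.bit_val],
        Nat.bit1_bits]
      rfl

lemma bits_injective : Function.Injective Nat.bits := fun m n h => by
  rw [← Nat.ofDigits_digits 2 m, ← Nat.ofDigits_digits 2 n, Nat.digits_two_eq_bits,
    Nat.digits_two_eq_bits, h]

namespace Memory

variable {α β : Type} {k : ℕ}

/-- Replace the content and the head position of one work tape and append to the output. -/
def put (m : Memory β TapeSymbol k) (r : Fin k) (T : ℕ → TapeSymbol) (h : ℕ) (o : List β) :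
    Memory β TapeSymbol k where
  inputHead := m.inputHead
  tape := Function.update m.tape r T
  head := Function.update m.head r h
  output := m.output ++ o

/-- The memory in which the work tapes hold the numbers `ρ i` in binary and their heads are on
cell `0`. -/
def registers (p : ℕ) (ρ : Fin k → ℕ) (o : List β) : Memory β TapeSymbol k where
  inputHead := p
  tape := fun i => listTape (ρ i).bits
  head := fun _ => 0
  output := o

/-- The one-tape lemmas act on the outermost `put`; commuting brings either of two tapes there. -/
lemma put_comm (m : Memory β TapeSymbol k) {r r' : Fin k} (hr : r ≠ r') (T T' : ℕ → TapeSymbol)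
    (h h' : ℕ) : (m.put r T h []).put r' T' h' [] = (m.put r' T' h' []).put r T h [] := by
  simp [put, Function.update_comm hr]

lemma put_self (m : Memory β TapeSymbol k) (r : Fin k) :
    m.put r (m.tape r) (m.head r) [] = m := by
  simp [put]

lemma registers_eq_put (p : ℕ) (ρ : Fin k → ℕ) (o : List β) (r : Fin k) :
    registers p ρ o = (registers p ρ o).put r (listTape (ρ r).bits) 0 [] :=
  ((registers p ρ o).put_self r).symm

lemma registers_put (p : ℕ) (ρ : Fin k → ℕ) (o o' : List β) (r : Fin k) (v : ℕ) :
    (registers p ρ o).put r (listTape v.bits) 0 o' =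
      registers p (Function.update ρ r v) (o ++ o') := by
  have : Function.update (fun i => listTape (ρ i).bits) r (listTape v.bits) =
      fun i => listTape (Function.update ρ r v i).bits := by
    funext i
    rcases eq_or_ne i r with rfl | h
    · simp
    · simp [h]
  simp [put, registers, this]

lemma InSpace.put {x : List α} {s : ℕ} {m : Memory β TapeSymbol k} (hm : m.InSpace x s)
    (r : Fin k) (T : ℕ → TapeSymbol) {h : ℕ} (hh : h < s) (o : List β) :
    (m.put r T h o).InSpace x s := by
  refine ⟨hm.1, fun i => ?_⟩
  rcases eq_or_ne i r with rfl | hi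
  · simpa [Memory.put] using hh
  · simpa [Memory.put, hi] using hm.2 i

lemma inSpace_registers {x : List α} {s p : ℕ} {ρ : Fin k → ℕ} {o : List β} (hs : 0 < s)
    (hp : p ≤ x.length + 1) : (registers p ρ o).InSpace x s :=
  ⟨hp, fun _ => hs⟩

end Memory

namespace Fragment

variable {α β : Type} {k : ℕ}

/-- One step on the work tape `r`: write `a`, move by `d` and emit `e`, depending on the scanned
symbol. -/
def tapeAct (r : Fin k) (a : TapeSymbol → TapeSymbol) (d : HeadMove)
    (e : TapeSymbol → Option β) : Fragment α β TapeSymbol k :=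
  act fun w =>
    { next := ()
      write := Function.update w r (a (w r))
      inputMove := .stay
      workMove := Function.update (fun _ => .stay) r d
      emit := e (w r) }

/-- Test the symbol scanned on the work tape `r`. -/
def tapeTest (r : Fin k) (t : TapeSymbol → Bool) : Fragment α β TapeSymbol k :=
  test fun _ w => t (w r)

def goRight (r : Fin k) : Fragment α β TapeSymbol k := tapeAct r id .right fun _ => none

def goLeft (r : Fin k) : Fragment α β TapeSymbol k := tapeAct r id .left fun _ => none

/-- Move the head of the work tape `r` to the mark. -/
def rewind (r : Fin k) : Fragment α β TapeSymbol k :=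
  loop (tapeTest r fun a => a ≠ some none) (goLeft r)

/-- Move the head of the work tape `r` from the mark to the last bit (or stay, if there is
none). -/
def goToLast (r : Fin k) : Fragment α β TapeSymbol k :=
  seq (goRight r) <| seq (loop (tapeTest r fun a => a ≠ none) (goRight r)) (goLeft r)

/-- Set the register `r` to `0`. -/
def clear (r : Fin k) : Fragment α β TapeSymbol k :=
  seq (goToLast r) <| loop (tapeTest r fun a => a ≠ some none)
    (tapeAct r (fun _ => none) .left fun _ => none)

/-- Write the register `r`, most significant bit first, and an end-of-vertex symbol. -/
def emitRegister (r : Fin k) : Fragment α PathSymbol TapeSymbol k :=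
  seq (goToLast r) <| seq
    (loop (tapeTest r fun a => a ≠ some none)
      (tapeAct r id .left fun a => a.join.map PathSymbol.bit))
    (tapeAct r id .stay fun _ => some .endVertex)

/-- Add `1` to the register `r`. -/
def increment (r : Fin k) : Fragment α β TapeSymbol k :=
  seq (goRight r) <| seq
    (loop (tapeTest r fun a => a = some (some true))
      (tapeAct r (fun _ => some (some false)) .right fun _ => none)) <|
  seq (tapeAct r (fun _ => some (some true)) .stay fun _ => none) (rewind r)

/-- Do the registers `r` and `r'` hold the same number? -/
def equal (r r' : Fin k) : Fragment α β TapeSymbol k :=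
  seq (seq (goRight r) (goRight r')) <| seq
    (loop (test fun _ w => w r = w r' ∧ w r ≠ none) (seq (goRight r) (goRight r'))) <|
  ite (test fun _ w => w r = w r')
    (seq (rewind r) <| seq (rewind r') <| ret true)
    (seq (rewind r) <| seq (rewind r') <| ret false)

/-- Emit a symbol. -/
def emitSymbol (e : β) : Fragment α β TapeSymbol k :=
  act fun w =>
    { next := (), write := w, inputMove := .stay, workMove := fun _ => .stay, emit := some e }

/-- Mark cell `0` of all work tapes. -/
def markTapes : Fragment α β TapeSymbol k :=
  act fun _ =>
    { next := (), write := fun _ => some none, inputMove := .stay, workMove := fun _ => .stay,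
      emit := none }

/-- Move the input head. -/
def moveInput (d : HeadMove) : Fragment α β TapeSymbol k :=
  act fun w => { next := (), write := w, inputMove := d, workMove := fun _ => .stay, emit := none }

/-- Test the scanned input cell. -/
def inputTest (t : InputCell α → Bool) : Fragment α β TapeSymbol k := test fun c _ => t c

/-- Move the input head to the left end. -/
def rewindInput : Fragment α β TapeSymbol k :=
  loop (inputTest fun c => match c with
    | .leftEnd => false
    | _ => true) (moveInput .left)

/-! ### Runs of the register operations, one tape at a time -/

section

variable {x : List α} {s : ℕ} {m : Memory β TapeSymbol k} {r : Fin k} {T : ℕ → TapeSymbol} {h : ℕ}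
  {o : List β}

lemma runs_tapeAct {a : TapeSymbol → TapeSymbol} {d : HeadMove} {e : TapeSymbol → Option β}
    {T' : ℕ → TapeSymbol} {h' : ℕ} {o' : List β}
    (hm : m.InSpace x s) (hh : h < s) (hh' : h' < s) (hT : Function.update T h (a (T h)) = T')
    (hd : Transducer.moveHead d h = h') (ho : o ++ (e (T h)).toList = o') :
    (tapeAct r a d e).Runs x s (m.put r T h o) true (m.put r T' h' o') := by
  subst hT hd ho
  have hw : (m.put r T h o).scan r = T h := by simp [Memory.scan, Memory.put]
  have key : (m.put r T h o).apply x
      { next := ()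
        write := Function.update (m.put r T h o).scan r (a ((m.put r T h o).scan r))
        inputMove := .stay
        workMove := Function.update (fun _ => .stay) r d
        emit := e ((m.put r T h o).scan r) : TransducerAction Unit TapeSymbol β k } =
      m.put r (Function.update T h (a (T h))) (Transducer.moveHead d h)
        (o ++ (e (T h)).toList) := by
    rw [hw]
    have h1 := hm.1
    simp only [Memory.apply, Memory.put, Transducer.moveHead, Memory.mk.injEq, List.append_assoc,
      and_true]
    refine ⟨by omega, ?_, ?_⟩
    · funext i
      rcases eq_or_ne i r with rfl | hi
      · simp
      · simp [hi, Memory.scan]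
    · funext i
      rcases eq_or_ne i r with rfl | hi
      · simp
      · simp [hi]
  rw [← key]
  exact runs_act (hm.put r T hh o) (by rw [key]; exact hm.put _ _ hh' _)

lemma runs_tapeTest {t : TapeSymbol → Bool} {b : Bool} (hm : m.InSpace x s) (hh : h < s)
    (hb : t (T h) = b) : (tapeTest r t).Runs x s (m.put r T h o) b (m.put r T h o) := by
  subst hb
  have := runs_test (fun _ w => t (w r)) (hm.put r T hh o)
  simpa only [tapeTest, Memory.scan, Memory.put, Function.update_self] using this

lemma runs_goRight (hm : m.InSpace x s) (hh : h + 1 < s) :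
    (goRight r).Runs x s (m.put r T h o) true (m.put r T (h + 1) o) :=
  runs_tapeAct hm (by omega) hh (by simp) rfl (by simp)

lemma runs_goLeft (hm : m.InSpace x s) (hh : h < s) :
    (goLeft r).Runs x s (m.put r T h o) true (m.put r T (h - 1) o) :=
  runs_tapeAct hm hh (by omega) (by simp) rfl (by simp)

lemma runs_rewind (l : List Bool) (hm : m.InSpace x s) (hh : h < s) :
    (rewind r).Runs x s (m.put r (listTape l) h o) true (m.put r (listTape l) 0 o) := by
  induction h with
  | zero => exact .loop_false (runs_tapeTest hm hh (by simp))
  | succ h ih =>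
    exact .loop_true (runs_tapeTest hm hh (by simp [listTape_succ_ne])) (runs_goLeft hm hh)
      (ih (by omega))

/-- The end of a numeral is recognised by the blank behind it, so cell `l.length + 1` is scanned.
This blank and the mark on cell `0` are the two extra cells in the bound `n.size + 2` below. -/
lemma runs_goToLast (l : List Bool) (hm : m.InSpace x s) (hh : l.length + 1 < s) :
    (goToLast r).Runs x s (m.put r (listTape l) 0 o) true (m.put r (listTape l) l.length o) := by
  refine (runs_goRight hm (by omega)).seq <| .seq (b := true) (m₁ := m.put r (listTape l)
    (l.length + 1) o) ?_ (runs_goLeft hm hh)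
  exact runs_loop (fun i => m.put r (listTape l) (i + 1) o) l.length
    (fun i hi => runs_tapeTest hm (by omega) (by simp [listTape, hi]))
    (fun i hi => runs_goRight hm (by omega)) (runs_tapeTest hm hh (by simp))

lemma runs_clear_tape (l : List Bool) (hm : m.InSpace x s) (hh : l.length + 1 < s) :
    (clear r).Runs x s (m.put r (listTape l) 0 o) true (m.put r (listTape []) 0 o) := by
  refine (runs_goToLast l hm hh).seq ?_
  induction l using List.reverseRecOn with
  | nil => exact .loop_false (runs_tapeTest hm (by omega) rfl)
  | append_singleton l b ih =>
    simp only [List.length_append, List.length_singleton] at hh ⊢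
    refine .loop_true (b := true) (runs_tapeTest hm (by omega) (by simp [listTape_succ_ne])) ?_
      (ih (by omega))
    exact runs_tapeAct hm (by omega) (by omega) (update_listTape_blank l b) rfl (by simp)

lemma runs_emit_tape {m : Memory PathSymbol TapeSymbol k} {o : List PathSymbol} (l : List Bool)
    (hm : m.InSpace x s) (hh : l.length + 1 < s) :
    (emitRegister r).Runs x s (m.put r (listTape l) 0 o) true
      (m.put r (listTape l) 0 (o ++ (l.reverse.map PathSymbol.bit ++ [.endVertex]))) := by
  refine (runs_goToLast l hm hh).seq <| .seq (b := true) (m₁ := m.put r (listTape l) 0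
    (o ++ l.reverse.map PathSymbol.bit)) ?_
    (runs_tapeAct hm (by omega) (by omega) (by simp) rfl (by simp))
  -- The tape stays as it is: `l₁` holds the bits still to be written, `l₂` those already written,
  -- so the induction removes bits from the end of `l₁`.
  suffices H : ∀ l₁ l₂ : List Bool, l = l₁ ++ l₂ → ∀ o, (loop (tapeTest r fun a => a ≠ some none)
      (tapeAct r id .left fun a => a.join.map PathSymbol.bit)).Runs x s
      (m.put r (listTape l) l₁.length o) true
      (m.put r (listTape l) 0 (o ++ l₁.reverse.map PathSymbol.bit)) from
    H l [] (by simp) o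
  intro l₁
  induction l₁ using List.reverseRecOn with
  | nil =>
    intro l₂ hl o
    simpa using Runs.loop_false (runs_tapeTest hm (by omega) (by simp))
  | append_singleton l₁ b ih =>
    intro l₂ hl o
    have hlen := congrArg List.length hl
    simp only [List.length_append, List.length_singleton] at hlen ⊢
    refine .loop_true (b := true) (m₂ := m.put r (listTape l) l₁.length (o ++ [.bit b]))
      (runs_tapeTest hm (by omega) (by simp [listTape_succ_ne])) ?_ ?_
    · refine runs_tapeAct hm (by omega) (by omega) (by simp) rfl ?_
      rw [hl, List.append_assoc, listTape_append_head]
      simp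
    · have e : o ++ (l₁ ++ [b]).reverse.map PathSymbol.bit =
          o ++ [.bit b] ++ l₁.reverse.map PathSymbol.bit := by simp
      rw [e]
      exact ih (b :: l₂) (by simpa using hl) (o ++ [.bit b])

lemma runs_increment_tape (l : List Bool) (hm : m.InSpace x s) (hh : l.length + 1 < s) :
    (increment r).Runs x s (m.put r (listTape l) 0 o) true
      (m.put r (listTape (succBits l)) 0 o) := by
  -- The carry has passed `l₁` and meets `l₂`. It stops at cell `h`, which holds a `0` or is the
  -- blank behind the numeral; `T` is the tape just before the final `1` is written there.
  suffices H : ∀ l₂ l₁ : List Bool, l₁.length + l₂.length + 1 < s → ∃ h < s, ∃ T,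
      (loop (tapeTest r fun a => a = some (some true))
        (tapeAct r (fun _ => some (some false)) .right fun _ => none)).Runs x s
      (m.put r (listTape (l₁ ++ l₂)) (l₁.length + 1) o) true (m.put r T h o) ∧
      Function.update T h (some (some true)) = listTape (l₁ ++ succBits l₂) by
    obtain ⟨h, hh', T, h₁, h₂⟩ := H l [] (by simpa using hh)
    exact (runs_goRight hm (by omega)).seq <| h₁.seq <|
      (runs_tapeAct hm hh' hh' h₂ rfl (by simp)).seq (runs_rewind _ hm hh')
  intro l₂
  induction l₂ with
  | nil =>
    intro l₁ hl
    exact ⟨_, hl, _, .loop_false (runs_tapeTest hm hl (by simp)),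
      by simpa [succBits] using update_listTape_length l₁ true⟩
  | cons b l₂ ih =>
    intro l₁ hl
    simp only [List.length_cons] at hl
    cases b
    · exact ⟨_, by omega, _,
        .loop_false (runs_tapeTest hm (by omega) (by simp [listTape_append_head])),
        update_listTape_append_cons _ _ _ _⟩
    · obtain ⟨h, hh', T, h₁, h₂⟩ := ih (l₁ ++ [false]) (by simp; omega)
      refine ⟨h, hh', T, .loop_true (b := true)
        (runs_tapeTest hm (by omega) (by simp [listTape_append_head]))
        (runs_tapeAct (h' := l₁.length + 2) hm (by omega) (by omega)
          (update_listTape_append_cons _ _ _ _) rfl rfl) ?_,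
        by simpa [succBits] using h₂⟩
      simpa using h₁

/-- Both heads advance together until the symbols differ or are both blank; the numerals agree iff
the symbols scanned at that moment agree. -/
lemma runs_equal_tapes {r' : Fin k} (hr : r ≠ r') (l l' : List Bool) (hm : m.InSpace x s)
    (hl : l.length + 1 < s) (hl' : l'.length + 1 < s) :
    (equal r r').Runs x s ((m.put r (listTape l) 0 []).put r' (listTape l') 0 []) (l = l')
      ((m.put r (listTape l) 0 []).put r' (listTape l') 0 []) := by
  have hput (h h' : ℕ) (hh : h < s) (hh' : h' < s) :
      ((m.put r (listTape l) h []).put r' (listTape l') h' []).InSpace x s :=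
    (hm.put _ _ hh _).put _ _ hh' _
  have hstep (h : ℕ) (hh : h + 1 < s) : (seq (goRight r) (goRight r')).Runs x s
      ((m.put r (listTape l) h []).put r' (listTape l') h []) true
      ((m.put r (listTape l) (h + 1) []).put r' (listTape l') (h + 1) []) := by
    refine .seq (b := true) (m₁ := (m.put r (listTape l) (h + 1) []).put r' (listTape l') h []) ?_
      (runs_goRight (hm.put _ _ hh _) hh)
    rw [Memory.put_comm m hr, Memory.put_comm m hr]
    exact runs_goRight (hm.put _ _ (by omega) _) hh
  have htest (t : (Fin k → TapeSymbol) → Bool) (b : Bool) (h : ℕ) (hh : h < s)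
      (hb : ∀ w, w r = listTape l h → w r' = listTape l' h → t w = b) :
      (test fun _ w => t w).Runs x s ((m.put r (listTape l) h []).put r' (listTape l') h []) b
        ((m.put r (listTape l) h []).put r' (listTape l') h []) := by
    have := runs_test (fun _ w => t w) (hput h h hh hh)
    rwa [hb _ (by simp [Memory.scan, Memory.put, hr]) (by simp [Memory.scan, Memory.put])] at this
  have hback (b : Bool) (h : ℕ) (hh : h < s) : (seq (rewind r) <| seq (rewind r') <| ret b).Runs x s
      ((m.put r (listTape l) h []).put r' (listTape l') h []) b
      ((m.put r (listTape l) 0 []).put r' (listTape l') 0 []) := by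
    refine .seq (b := true) (m₁ := (m.put r (listTape l) 0 []).put r' (listTape l') h []) ?_ <|
      (runs_rewind _ (hm.put _ _ (by omega) _) hh).seq (runs_ret (hput _ _ (by omega) (by omega)))
    rw [Memory.put_comm m hr, Memory.put_comm m hr]
    exact runs_rewind _ (hm.put _ _ hh _) hh
  -- `q` is the common prefix already compared; `p` and `p'` are the remainders.
  suffices H : ∀ p q p' : List Bool, l = q ++ p → l' = q ++ p' → ∃ h < s,
      (loop (test fun _ w => w r = w r' ∧ w r ≠ none) (seq (goRight r) (goRight r'))).Runs x s
      ((m.put r (listTape l) (q.length + 1) []).put r' (listTape l') (q.length + 1) []) true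
      ((m.put r (listTape l) h []).put r' (listTape l') h []) ∧
      (listTape l h = listTape l' h ↔ p = p') by
    obtain ⟨h, hh, h₁, h₂⟩ := H l [] l' rfl rfl
    refine (hstep 0 (by omega)).seq (h₁.seq ?_)
    by_cases hll : l = l'
    · rw [decide_eq_true hll]
      exact (htest (fun w => w r = w r') true h hh fun w h₃ h₄ => decide_eq_true
        (by rw [h₃, h₄]; exact h₂.2 hll)).ite_true (hback _ _ hh)
    · rw [decide_eq_false hll]
      exact (htest (fun w => w r = w r') false h hh fun w h₃ h₄ => decide_eq_false
        (by rw [h₃, h₄]; exact fun h => hll (h₂.1 h))).ite_false (hback _ _ hh)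
  intro p
  induction p with
  | nil =>
    intro q p' hq hq'
    have h₁ := listTape_append_head q []
    have h₂ := listTape_append_head q p'
    rw [← hq] at h₁
    rw [← hq'] at h₂
    have hlen := congrArg List.length hq
    simp only [List.append_nil] at hlen
    refine ⟨_, by omega, .loop_false (htest (fun w => w r = w r' ∧ w r ≠ none) _ _ (by omega) ?_), ?_⟩
    · intro w hw _
      simp [hw, h₁]
    · rw [h₁, h₂]
      cases p' <;> simp
  | cons a p ih =>
    intro q p' hq hq'
    have h₁ := listTape_append_head q (a :: p)
    have h₂ := listTape_append_head q p'
    rw [← hq] at h₁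
    rw [← hq'] at h₂
    have hlen := congrArg List.length hq
    simp only [List.length_append, List.length_cons] at hlen
    by_cases hab : p'.head? = some a
    · obtain ⟨p'', rfl⟩ := List.head?_eq_some_iff.1 hab
      obtain ⟨h, hh, h₃, h₄⟩ := ih (q ++ [a]) p'' (by simpa using hq) (by simpa using hq')
      refine ⟨h, hh, .loop_true (htest (fun w => w r = w r' ∧ w r ≠ none) _ _ (by omega) ?_)
        (hstep _ (by omega)) (by simpa using h₃), by simpa using h₄⟩
      intro w hw hw'
      simp [hw, hw', h₁, h₂]
    · refine ⟨_, by omega, .loop_false (htest (fun w => w r = w r' ∧ w r ≠ none) _ _ (by omega) ?_),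
        ?_⟩
      · intro w hw hw'
        rw [hw, hw', h₁, h₂]
        rcases p' with _ | ⟨b, p'⟩
        · simp
        · simp [show a ≠ b from fun h => hab (by simp [h])]
      · rw [h₁, h₂]
        rcases p' with _ | ⟨b, p'⟩
        · simp
        · simp [show a ≠ b from fun h => hab (by simp [h])]

end

/-! #### Operations on registers -/

section

variable {x : List α} {s n p : ℕ} {ρ : Fin k → ℕ} {o : List β} {r r' : Fin k}

lemma bits_length_le {v : ℕ} (hs : n.size + 2 ≤ s) (hv : v ≤ n) : v.bits.length + 1 < s := by
  have := Nat.size_le_size hv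
  rw [Nat.size_eq_bits_len]
  omega

lemma runs_clear (hs : n.size + 2 ≤ s) (hp : p ≤ x.length + 1) (hr : ρ r ≤ n) :
    (clear r).Runs x s (.registers p ρ o) true (.registers p (Function.update ρ r 0) o) := by
  have := runs_clear_tape (r := r) (o := []) (ρ r).bits
    (Memory.inSpace_registers (ρ := ρ) (o := o) (by omega) hp) (bits_length_le hs hr)
  rw [← Memory.registers_eq_put] at this
  rw [← Nat.zero_bits] at this
  simpa only [Memory.registers_put, List.append_nil] using this

/-- Only the old value has to be at most `n`: a carry out of the last bit goes into the blank cell,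
which is already accounted for. -/
lemma runs_increment (hs : n.size + 2 ≤ s) (hp : p ≤ x.length + 1) (hr : ρ r ≤ n) :
    (increment r).Runs x s (.registers p ρ o) true
      (.registers p (Function.update ρ r (ρ r + 1)) o) := by
  have := runs_increment_tape (r := r) (o := []) (ρ r).bits
    (Memory.inSpace_registers (ρ := ρ) (o := o) (by omega) hp) (bits_length_le hs hr)
  rw [← Memory.registers_eq_put] at this
  rw [← bits_succ] at this
  simpa only [Memory.registers_put, List.append_nil] using this

lemma runs_equal (hs : n.size + 2 ≤ s) (hp : p ≤ x.length + 1) (hrr : r ≠ r') (hr : ρ r ≤ n)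
    (hr' : ρ r' ≤ n) :
    (equal r r').Runs x s (.registers p ρ o) (ρ r = ρ r') (.registers p ρ o) := by
  have := runs_equal_tapes hrr (ρ r).bits (ρ r').bits
    (Memory.inSpace_registers (ρ := ρ) (o := o) (by omega) hp) (bits_length_le hs hr)
    (bits_length_le hs hr')
  rw [← Memory.registers_eq_put, ← Memory.registers_eq_put] at this
  simpa only [bits_injective.eq_iff] using this

lemma runs_emitRegister {o : List PathSymbol} (hs : n.size + 2 ≤ s) (hp : p ≤ x.length + 1)
    (hr : ρ r ≤ n) :
    (emitRegister r).Runs x s (.registers p ρ o) true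
      (.registers p ρ (o ++ ((ρ r).bits.reverse.map PathSymbol.bit ++ [.endVertex]))) := by
  have := runs_emit_tape (r := r) (o := []) (ρ r).bits
    (Memory.inSpace_registers (ρ := ρ) (o := o) (by omega) hp) (bits_length_le hs hr)
  rw [← Memory.registers_eq_put] at this
  simpa only [Memory.registers_put, List.nil_append, Function.update_eq_self] using this

lemma runs_emitSymbol {e : β} (hs : 0 < s) (hp : p ≤ x.length + 1) :
    (emitSymbol e).Runs x s (.registers p ρ o) true (.registers p ρ (o ++ [e])) := by
  have key : (Memory.registers p ρ o).apply x
      { next := (), write := (Memory.registers p ρ o : Memory β TapeSymbol k).scan,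
        inputMove := .stay, workMove := fun _ => .stay,
        emit := some e : TransducerAction Unit TapeSymbol β k } =
      .registers p ρ (o ++ [e]) := by
    simpa [Memory.apply, Memory.registers, Transducer.moveHead, Memory.scan] using hp
  rw [← key]
  exact runs_act (Memory.inSpace_registers hs hp)
    (by rw [key]; exact Memory.inSpace_registers hs hp)

lemma runs_moveInput {d : HeadMove} {p' : ℕ} (hs : 0 < s) (hp : p ≤ x.length + 1)
    (hp' : p' ≤ x.length + 1) (hd : Transducer.moveHead d p = p') :
    (moveInput d).Runs x s (.registers p ρ o) true (.registers p' ρ o) := by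
  have key : (Memory.registers p ρ o).apply x
      { next := (), write := (Memory.registers p ρ o : Memory β TapeSymbol k).scan,
        inputMove := d, workMove := fun _ => .stay,
        emit := none : TransducerAction Unit TapeSymbol β k } = .registers p' ρ o := by
    simpa [Memory.apply, Memory.registers, Transducer.moveHead, Memory.scan, ← hd] using hp'
  rw [← key]
  exact runs_act (Memory.inSpace_registers hs hp)
    (by rw [key]; exact Memory.inSpace_registers hs hp')

lemma runs_markTapes (hs : 0 < s) :
    (markTapes : Fragment α β TapeSymbol k).Runs x s (.init none) true
      (.registers 0 (fun _ => 0) []) := by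
  have key : (Memory.init none : Memory β TapeSymbol k).apply x
      { next := (), write := fun _ => some none,
        inputMove := .stay, workMove := fun _ => .stay,
        emit := none : TransducerAction Unit TapeSymbol β k } = .registers 0 (fun _ => 0) [] := by
    have h0 : Function.update (fun _ => none : ℕ → TapeSymbol) 0 (some none) = listTape [] := by
      funext j
      rcases j with _ | j <;> simp [listTape]
    simp [Memory.apply, Memory.registers, Transducer.moveHead, Memory.init, h0]
  rw [← key]
  exact runs_act ⟨by simp [Memory.init], fun _ => hs⟩
    (by rw [key]; exact Memory.inSpace_registers hs (by omega))

lemma runs_inputTest {t : InputCell α → Bool} {b : Bool} (hs : 0 < s) (hp : p ≤ x.length + 1)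
    (hb : t (Transducer.inputCell x p) = b) :
    (inputTest t).Runs x s (.registers p ρ o : Memory β TapeSymbol k) b (.registers p ρ o) := by
  subst hb
  exact runs_test (fun c _ => t c) (Memory.inSpace_registers hs hp)

lemma runs_rewindInput (hs : 0 < s) (hp : p ≤ x.length + 1) :
    rewindInput.Runs x s (.registers p ρ o : Memory β TapeSymbol k) true (.registers 0 ρ o) := by
  induction p with
  | zero => exact .loop_false (runs_inputTest hs hp rfl)
  | succ p ih =>
    refine .loop_true (runs_inputTest hs hp ?_) (runs_moveInput (p' := p) hs hp (by omega) rfl)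
      (ih (by omega))
    simp only [Transducer.inputCell]
    cases x[p]? <;> rfl

end

end Fragment

/-! ### The algorithm -/

/-- The word `x` is the `n × n` matrix `A`, row by row. -/
structure IsMatrixWord (x : List GraphSymbol) (n : ℕ) (A : ℕ → ℕ → Bool) : Prop where
  length_eq : x.length = n * (n + 1)
  bit {u v : ℕ} : u < n → v < n → x[u * (n + 1) + v]? = some (.bit (A u v))
  endRow {u : ℕ} : u < n → x[u * (n + 1) + n]? = some .endRow

/-- The arc `(u, v)` is followed by the arc `(v, w)`: for some `i`, the vertex `u` is the `i`-th
in-neighbour of `v` and `w` is the `i`-th out-neighbour of `v`. -/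
def followedBy (A : ℕ → ℕ → Bool) (u v w : ℕ) : Bool :=
  A u v && (A v w && decide (Nat.count (fun i => A i v) u = Nat.count (fun i => A v i) w))

/-- The vertices after `u` on the walk that starts with the arc `(u, v)` and proceeds from each
arc to the one that follows it. -/
inductive IsTrace (A : ℕ → ℕ → Bool) {n : ℕ} : Fin n → Fin n → List (Fin n) → Prop
  | last {u v : Fin n} : (∀ w < n, followedBy A u v w = false) → IsTrace A u v [v]
  | cons {u v w : Fin n} {l : List (Fin n)} : (∀ i < (w : ℕ), followedBy A u v i = false) →
      followedBy A u v w = true → IsTrace A v w l → IsTrace A u v (v :: l)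

namespace Fragment

variable {α β : Type} {k : ℕ}

/-- Run `B` with the register `t` counting from `0` up to the value of the register `a`, and reset
the register `t`. -/
def forLoop (t a : Fin k) (B : Fragment α β TapeSymbol k) : Fragment α β TapeSymbol k :=
  seq (loop (not (equal t a)) (seq B (increment t))) (clear t)

/-- Copy the register `a` to the register `b`. -/
def copy (a b : Fin k) : Fragment α β TapeSymbol k :=
  seq (clear b) (loop (not (equal b a)) (increment b))

/-- Set the register `z` to the first number for which `T` succeeds, or to the value of the
register `N`, if there is no smaller one. -/
def search (z N : Fin k) (T : Fragment α β TapeSymbol k) : Fragment α β TapeSymbol k :=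
  seq (clear z) (loop (and (not (equal z N)) (not T)) (increment z))

section

variable {x : List α} {s n p : ℕ} {ρ : Fin k → ℕ} {o : List β}

/-- Before pass `i` the registers are `σ i` with `t` overridden by `i`, the input head is at `q i`
and the output is `e i`. The body has to preserve the counter `t`, which is incremented only
afterwards, and the bound in `a`. -/
lemma runs_forLoop {t a : Fin k} {B : Fragment α β TapeSymbol k} (σ : ℕ → Fin k → ℕ) (q : ℕ → ℕ)
    (e : ℕ → List β) {K : ℕ} (hs : n.size + 2 ≤ s) (hK : K ≤ n) (hta : t ≠ a)
    (hσ : ∀ i ≤ K, σ i a = K) (hq : ∀ i ≤ K, q i ≤ x.length + 1)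
    (hB : ∀ i < K, B.Runs x s (.registers (q i) (Function.update (σ i) t i) (e i)) true
      (.registers (q (i + 1)) (Function.update (σ (i + 1)) t i) (e (i + 1)))) :
    (forLoop t a B).Runs x s (.registers (q 0) (Function.update (σ 0) t 0) (e 0)) true
      (.registers (q K) (Function.update (σ K) t 0) (e K)) := by
  have htest (i : ℕ) (hi : i ≤ K) (b : Bool) (hb : b = !decide (i = K)) :
      (not (equal t a)).Runs x s
      (.registers (q i) (Function.update (σ i) t i) (e i)) b
      (.registers (q i) (Function.update (σ i) t i) (e i)) := by
    have := (runs_equal (ρ := Function.update (σ i) t i) (o := e i) hs (hq i hi) hta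
      (by simpa using hi.trans hK) (by simpa [hta.symm, hσ i hi] using hK)).not
    simpa [hta.symm, hσ i hi, hb] using this
  refine .seq (runs_loop (fun i => .registers (q i) (Function.update (σ i) t i) (e i)) K
    (fun i hi => htest i hi.le _ (by simp [hi.ne])) (fun i hi => (hB i hi).seq ?_)
    (htest K le_rfl _ (by simp))) ?_
  · simpa using runs_increment (ρ := Function.update (σ (i + 1)) t i) (o := e (i + 1)) (r := t) hs
      (hq (i + 1) hi) (by simpa using hi.le.trans hK)
  · simpa using runs_clear (ρ := Function.update (σ K) t K) (o := e K) (r := t) hs (hq K le_rfl)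
      (by simpa using hK)

lemma runs_copy {a b : Fin k} (hs : n.size + 2 ≤ s) (hp : p ≤ x.length + 1) (hab : b ≠ a)
    (ha : ρ a ≤ n) (hb : ρ b ≤ n) :
    (copy a b).Runs x s (.registers p ρ o) true
      (.registers p (Function.update ρ b (ρ a)) o) := by
  have htest (i : ℕ) (hi : i ≤ ρ a) (c : Bool) (hc : c = !decide (i = ρ a)) :
      (not (equal b a)).Runs x s (.registers p (Function.update ρ b i) o) c
      (.registers p (Function.update ρ b i) o) := by
    have := (runs_equal (ρ := Function.update ρ b i) (o := o) hs hp hab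
      (by simpa using hi.trans ha) (by simpa [hab.symm] using ha)).not
    simpa [hab.symm, hc] using this
  refine (runs_clear hs hp hb).seq <| runs_loop (fun i => .registers p (Function.update ρ b i) o) _
    (fun i hi => htest i hi.le _ (by simp [hi.ne])) (fun i hi => ?_) (htest _ le_rfl _ (by simp))
  simpa using runs_increment (ρ := Function.update ρ b i) (o := o) (r := b) hs hp
    (by simpa using hi.le.trans ha)

/-- The result `n` stands for failure; `T` is never run at `n`, which is not a vertex, so success at
`K` is required only for `K < n`. -/
lemma runs_search {z N : Fin k} {T : Fragment α β TapeSymbol k} {K : ℕ} (hs : n.size + 2 ≤ s)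
    (hp : p ≤ x.length + 1) (hz : z ≠ N) (hN : ρ N = n) (hρ : ρ z ≤ n) (hK : K ≤ n)
    (hT : ∀ i < K, T.Runs x s (.registers p (Function.update ρ z i) o) false
      (.registers p (Function.update ρ z i) o))
    (hT' : K < n → T.Runs x s (.registers p (Function.update ρ z K) o) true
      (.registers p (Function.update ρ z K) o)) :
    (search z N T).Runs x s (.registers p ρ o) true
      (.registers p (Function.update ρ z K) o) := by
  have htest (i : ℕ) (hi : i ≤ n) : (not (equal z N)).Runs x s
      (.registers p (Function.update ρ z i) o) (!decide (i = n))
      (.registers p (Function.update ρ z i) o) := by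
    have := (runs_equal (ρ := Function.update ρ z i) (o := o) hs hp hz
      (by simpa using hi) (by simp [hz.symm, hN])).not
    simpa [hz.symm, hN] using this
  refine (runs_clear hs hp hρ).seq <| runs_loop (fun i => .registers p (Function.update ρ z i) o) K
    (fun i hi => ?_) (fun i hi => ?_) ?_
  · have := (htest i (by omega)).and fun _ => (hT i hi).not
    simpa [show i ≠ n by omega] using this
  · simpa using runs_increment (ρ := Function.update ρ z i) (o := o) (r := z) hs hp
      (by simpa using hi.le.trans hK)
  -- If `K = n`, the first test fails and `T` is not run; otherwise the negation of `T` yields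
  -- `false`.
  · have := (htest K hK).and (b' := false) fun h => by
      simpa using (hT' (lt_of_le_of_ne hK (by simpa using h))).not
    simpa using this

end

/-! #### The registers -/

-- the number of vertices
local notation "rN" => (0 : Fin 10)
-- the tail of the current first arc
local notation "rV" => (1 : Fin 10)
-- the head of the current first arc
local notation "rW" => (2 : Fin 10)
-- the tail of the current arc
local notation "rX" => (3 : Fin 10)
-- the head of the current arc
local notation "rY" => (4 : Fin 10)
-- the result of a search
local notation "rZ" => (5 : Fin 10)
-- the loop variable in the computation of ranks
local notation "rT" => (6 : Fin 10)
-- the rank of an in-neighbour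
local notation "rC" => (7 : Fin 10)
-- the rank of an out-neighbour
local notation "rD" => (8 : Fin 10)
-- the loop variable in the access to the matrix
local notation "rQ" => (9 : Fin 10)

def isBit : InputCell GraphSymbol → Bool
  | .symbol (.bit _) => true
  | _ => false

def isOne : InputCell GraphSymbol → Bool
  | .symbol (.bit b) => b
  | _ => false

/-- The fragments of the algorithm. -/
abbrev GraphFragment : Type 1 := Fragment GraphSymbol PathSymbol TapeSymbol 10

/-- Move the input head to the beginning of the next row. -/
def skipRow : GraphFragment :=
  seq (loop (inputTest isBit) (moveInput .right)) (moveInput .right)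

/-- Is there an arc from the vertex in the register `a` to the vertex in the register `b`? -/
def adjacent (a b : Fin 10) : GraphFragment :=
  seq (moveInput .right) <| seq (forLoop rQ a skipRow) <|
  seq (forLoop rQ b (moveInput .right)) <|
  ite (inputTest isOne) (seq rewindInput (ret true)) (seq rewindInput (ret false))

/-- Add to the register `c` the number of the values of `rT` below the register `a` for which `T`
succeeds. -/
def rank (c a : Fin 10) (T : GraphFragment) : GraphFragment :=
  forLoop rT a (when T (increment c))

/-- Is the arc from the register `a` to the register `b` followed by the one from `b` to `e`? -/
def followed (a b e : Fin 10) : GraphFragment :=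
  and (adjacent a b) <| and (adjacent b e) <|
  seq (rank rC a (adjacent rT b)) <| seq (rank rD e (adjacent b rT)) <|
  ite (equal rC rD) (seq (clear rC) <| seq (clear rD) <| ret true)
    (seq (clear rC) <| seq (clear rD) <| ret false)

/-- Write the vertices after `rX` on the walk that starts with the arc from `rX` to `rY`. -/
def writeTrace : GraphFragment :=
  loop (not (equal rY rN)) <| seq (emitRegister rY) <| seq (search rZ rN (followed rX rY rZ)) <|
    seq (copy rY rX) (copy rZ rY)

/-- If there is an arc from `rV` to `rW` and it does not follow another one, write the path that
starts with it. -/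
def writePath : GraphFragment :=
  when (adjacent rV rW) <| seq (search rZ rN (followed rZ rV rW)) <|
  seq (when (equal rZ rN) <| seq (emitRegister rV) <| seq (copy rV rX) <| seq (copy rW rY) <|
    seq writeTrace <| seq (emitSymbol .endPath) <| seq (clear rX) (clear rY)) (clear rZ)

/-- Store the number of vertices. -/
def readSize : GraphFragment :=
  seq (moveInput .right) <|
  seq (loop (inputTest isBit) <| seq (moveInput .right) (increment rN)) rewindInput

/-- Write a path decomposition of the input digraph. -/
def writePaths : GraphFragment :=
  seq markTapes <| seq readSize <| forLoop rV rN <| forLoop rW rN writePath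

/-! ### Correctness of the fragments of the algorithm -/

section

variable {x : List GraphSymbol} {s n p : ℕ} {A : ℕ → ℕ → Bool} {ρ : Fin 10 → ℕ}
  {o : List PathSymbol}

lemma _root_.IsMatrixWord.index_le (hx : IsMatrixWord x n A) {u v : ℕ} (hu : u < n) (hv : v ≤ n) :
    u * (n + 1) + v + 1 ≤ x.length := by
  rw [hx.length_eq]
  nlinarith

/-- A row has `n + 1` symbols with its end mark, and the left end marker shifts all cells by one; so
row `u` begins at cell `u * (n + 1) + 1`. -/
lemma runs_skipRow (hx : IsMatrixWord x n A) (hs : 0 < s) {u : ℕ} (hu : u < n) :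
    skipRow.Runs x s (.registers (u * (n + 1) + 1) ρ o) true
      (.registers ((u + 1) * (n + 1) + 1) ρ o) := by
  have h := fun v (hv : v ≤ n) => hx.index_le hu hv
  refine .seq (b := true) (m₁ := .registers (u * (n + 1) + n + 1) ρ o) (runs_loop
      (fun i => .registers (u * (n + 1) + i + 1) ρ o) n (fun i hi => ?_) (fun i hi => ?_) ?_)
    (runs_moveInput hs (by have := h n le_rfl; omega) ?_ ?_)
  · exact runs_inputTest hs (by have := h i hi.le; omega)
      (by simp [Transducer.inputCell, hx.bit hu hi, isBit])
  · exact runs_moveInput hs (by have := h i hi.le; omega) (by have := h (i + 1) hi; omega) rfl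
  · exact runs_inputTest hs (by have := h n le_rfl; omega)
      (by simp [Transducer.inputCell, hx.endRow hu, isBit])
  · have := h n le_rfl
    linarith
  · simp only [Transducer.moveHead]
    ring

/-- The position of the entry is never stored; rows and columns are counted off with `rQ`. The input
head ends where it began, so the test leaves no trace and can be nested. -/
lemma runs_adjacent (hx : IsMatrixWord x n A) (hs : n.size + 2 ≤ s) {a b : Fin 10} (ha : rQ ≠ a)
    (hb : rQ ≠ b) (hq : ρ rQ = 0) (han : ρ a < n) (hbn : ρ b < n) :
    (adjacent a b).Runs x s (.registers 0 ρ o) (A (ρ a) (ρ b)) (.registers 0 ρ o) := by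
  have hidx := hx.index_le han hbn.le
  have hρ : Function.update ρ rQ 0 = ρ := by rw [← hq, Function.update_eq_self]
  have h₁ := runs_forLoop (x := x) (n := n) (a := a) (K := ρ a) (B := skipRow) (fun _ => ρ)
    (fun i => i * (n + 1) + 1) (fun _ => o) hs han.le ha (fun _ _ => rfl)
    (fun i hi => by have := Nat.mul_le_mul_right (n + 1) hi; omega)
    (fun i hi => runs_skipRow hx (by omega) (by omega))
  have h₂ := runs_forLoop (x := x) (n := n) (a := b) (K := ρ b) (B := moveInput .right)
    (fun _ => ρ) (fun i => ρ a * (n + 1) + i + 1) (fun _ => o) hs hbn.le hb (fun _ _ => rfl)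
    (fun i hi => by omega)
    (fun i hi => runs_moveInput (by omega) (by omega) (by omega) rfl)
  simp only [hρ, zero_mul, zero_add, add_zero] at h₁ h₂
  refine (runs_moveInput (p' := 1) (by omega) (by omega) (by omega) rfl).seq <| h₁.seq <| h₂.seq ?_
  have h₃ := runs_inputTest (ρ := ρ) (o := o) (t := isOne) (b := A (ρ a) (ρ b))
    (show 0 < s by omega) (show ρ a * (n + 1) + ρ b + 1 ≤ x.length + 1 by omega)
    (by simp [Transducer.inputCell, hx.bit han hbn, isOne])
  have h₄ (c : Bool) : (seq rewindInput (ret c)).Runs x s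
      (.registers (ρ a * (n + 1) + ρ b + 1) ρ o) c (.registers 0 ρ o) :=
    (runs_rewindInput (by omega) (by omega)).seq
      (runs_ret (Memory.inSpace_registers (by omega) (by omega)))
  cases hA : A (ρ a) (ρ b)
  · rw [hA] at h₃
    exact h₃.ite_false (h₄ _)
  · rw [hA] at h₃
    exact h₃.ite_true (h₄ _)

/-- After `i` passes `c` holds the number of successes below `i`. Since `T` runs while `c` holds a
partial count, its behaviour is assumed for every content `j` of `c`. -/
lemma runs_rank (hs : n.size + 2 ≤ s) {c a : Fin 10} {T : GraphFragment} (f : ℕ → Bool)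
    (hc : rT ≠ c) (ha : rT ≠ a) (hac : a ≠ c) (hc0 : ρ c = 0) (ht0 : ρ rT = 0) (han : ρ a < n)
    (hT : ∀ i < ρ a, ∀ j, T.Runs x s
      (.registers 0 (Function.update (Function.update ρ c j) rT i) o) (f i)
      (.registers 0 (Function.update (Function.update ρ c j) rT i) o)) :
    (rank c a T).Runs x s (.registers 0 ρ o) true
      (.registers 0 (Function.update ρ c (Nat.count (fun i => f i) (ρ a))) o) := by
  have h := runs_forLoop (x := x) (n := n) (t := rT) (a := a) (K := ρ a)
    (B := when T (increment c)) (fun i => Function.update ρ c (Nat.count (fun i => f i) i))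
    (fun _ => 0) (fun _ => o) hs han.le ha (fun _ _ => by simp [hac]) (fun _ _ => by omega)
    (fun i hi => by
      have hTi := hT i hi (Nat.count (fun i => f i) i)
      rw [Nat.count_succ]
      cases hf : f i
      · rw [hf] at hTi
        simpa using hTi.when_false
      · rw [hf] at hTi
        have hle : Nat.count (fun i => f i) i ≤ i := Nat.count_le _
        have hcomm (v : ℕ) := Function.update_comm hc.symm v i ρ
        refine hTi.when_true ?_
        have := runs_increment (x := x) (p := 0) (o := o) (r := c)
          (ρ := Function.update (Function.update ρ rT i) c (Nat.count (fun i => f i) i)) hs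
          (by omega) (by simp; omega)
        simpa [hcomm] using this)
  have e₁ (v : ℕ) : Function.update (Function.update ρ c v) rT 0 = Function.update ρ c v := by
    rw [Function.update_eq_self_iff]
    simp [hc, ht0]
  have e₂ : Function.update ρ c 0 = ρ := by rw [← hc0, Function.update_eq_self]
  have e₃ : Function.update ρ rT 0 = ρ := by rw [← ht0, Function.update_eq_self]
  simp only [e₁, Nat.count_zero, e₂, e₃] at h
  exact h

/-- The arguments lie below `rT`, apart from the scratch registers, which are `0` before and after;
so this is again a test without side effect. -/
lemma runs_followed (hx : IsMatrixWord x n A) (hs : n.size + 2 ≤ s) {a b e : Fin 10}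
    (ha : a < rT) (hb : b < rT) (he : e < rT) (hρ : ∀ i ≥ rT, ρ i = 0) (han : ρ a < n)
    (hbn : ρ b < n) (hen : ρ e < n) :
    (followed a b e).Runs x s (.registers 0 ρ o) (followedBy A (ρ a) (ρ b) (ρ e))
      (.registers 0 ρ o) := by
  have hne {i j : Fin 10} (hi : i < rT) (hj : rT ≤ j) : j ≠ i := by rintro rfl; omega
  refine (runs_adjacent hx hs (hne ha (by decide)) (hne hb (by decide)) (hρ _ (by decide)) han
    hbn).and fun _ => (runs_adjacent hx hs (hne hb (by decide)) (hne he (by decide))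
      (hρ _ (by decide)) hbn hen).and fun _ => ?_
  set c := Nat.count (fun i => A i (ρ b)) (ρ a) with hc
  set d := Nat.count (fun i => A (ρ b) i) (ρ e) with hd
  have hcn : c ≤ n := (Nat.count_le _).trans han.le
  have hdn : d ≤ n := (Nat.count_le _).trans hen.le
  set ρ₁ := Function.update ρ rC c with hρ₁
  set ρ₂ := Function.update ρ₁ rD d with hρ₂
  have h₁ : (rank rC a (adjacent rT b)).Runs x s (.registers 0 ρ o) true (.registers 0 ρ₁ o) := by
    refine runs_rank hs (fun i => A i (ρ b)) (by decide) (hne ha (by decide))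
      (hne ha (by decide)).symm (hρ _ (by decide)) (hρ _ (by decide)) han fun i hi j => ?_
    have hbT : b ≠ rT := (hne hb (by decide)).symm
    have hbC : b ≠ rC := (hne hb (by decide)).symm
    have := runs_adjacent (ρ := Function.update (Function.update ρ rC j) rT i) (o := o) hx hs
      (a := rT) (b := b) (by decide) (hne hb (by decide)) (by simp [hρ]) (by simp; omega)
      (by simpa [hbT, hbC] using hbn)
    simpa [hbT, hbC] using this
  have h₂ : (rank rD e (adjacent b rT)).Runs x s (.registers 0 ρ₁ o) true
      (.registers 0 ρ₂ o) := by
    have hbT : b ≠ rT := (hne hb (by decide)).symm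
    have hbC : b ≠ rC := (hne hb (by decide)).symm
    have hbD : b ≠ rD := (hne hb (by decide)).symm
    have heC : e ≠ rC := (hne he (by decide)).symm
    have := runs_rank (x := x) (ρ := ρ₁) (o := o) (c := rD) (a := e) (T := adjacent b rT) hs
      (fun i => A (ρ b) i) (by decide) (hne he (by decide))
      (hne he (by decide)).symm (by simp [hρ₁, hρ]) (by simp [hρ₁, hρ]) (by simpa [hρ₁, heC])
      fun i hi j => by
        have := runs_adjacent (ρ := Function.update (Function.update ρ₁ rD j) rT i) (o := o) hx hs
          (a := b) (b := rT) (hne hb (by decide)) (by decide) (by simp [hρ₁, hρ])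
          (by simpa [hρ₁, hbT, hbC, hbD] using hbn)
          (by simp [hρ₁, heC] at hi ⊢; omega)
        simpa [hρ₁, hbT, hbC, hbD] using this
    simpa [hρ₁, heC, hρ₂, hd] using this
  have h₃ : (equal rC rD).Runs x s (.registers 0 ρ₂ o) (c = d) (.registers 0 ρ₂ o) := by
    have := runs_equal (x := x) (ρ := ρ₂) (o := o) (r := rC) (r' := rD) (p := 0) hs (by omega)
      (by decide) (by simpa [hρ₂, hρ₁] using hcn) (by simpa [hρ₂, hρ₁] using hdn)
    simpa [hρ₂, hρ₁] using this
  have h₄ (b : Bool) : (seq (clear rC) <| seq (clear rD) <| ret b : GraphFragment).Runs x s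
      (.registers 0 ρ₂ o) b (.registers 0 ρ o) := by
    have h := (runs_clear (x := x) (ρ := ρ₂) (o := o) (r := rC) (p := 0) hs (by omega)
      (by simpa [hρ₂, hρ₁] using hcn)).seq <| (runs_clear (r := rD) hs (by omega)
      (by simpa [hρ₂, hρ₁] using hdn)).seq <| runs_ret (b := b)
        (Memory.inSpace_registers (by omega) (by omega))
    have hfin : Function.update (Function.update ρ₂ rC 0) rD 0 = ρ := by
      funext i
      by_cases h1 : i = rD
      · subst h1; simp [hρ]
      · by_cases h2 : i = rC
        · subst h2; simp [hρ]
        · simp [hρ₂, hρ₁, h1, h2]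
    rwa [hfin] at h
  refine h₁.seq <| h₂.seq ?_
  by_cases hcd : c = d
  · rw [decide_eq_true hcd] at h₃ ⊢
    exact h₃.ite_true (h₄ _)
  · rw [decide_eq_false hcd] at h₃ ⊢
    exact h₃.ite_false (h₄ _)

/-- The registers when all loop variables and ranks are `0`. -/
def regs (n v w a b z : ℕ) : Fin 10 → ℕ := ![n, v, w, a, b, z, 0, 0, 0, 0]

section regs

variable (n v w a b z i : ℕ)

lemma update_regs_N : Function.update (regs n v w a b z) rN i = regs i v w a b z := by
  funext j; fin_cases j <;> rfl

lemma update_regs_V : Function.update (regs n v w a b z) rV i = regs n i w a b z := by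
  funext j; fin_cases j <;> rfl

lemma update_regs_W : Function.update (regs n v w a b z) rW i = regs n v i a b z := by
  funext j; fin_cases j <;> rfl

lemma update_regs_X : Function.update (regs n v w a b z) rX i = regs n v w i b z := by
  funext j; fin_cases j <;> rfl

lemma update_regs_Y : Function.update (regs n v w a b z) rY i = regs n v w a i z := by
  funext j; fin_cases j <;> rfl

lemma update_regs_Z : Function.update (regs n v w a b z) rZ i = regs n v w a b i := by
  funext j; fin_cases j <;> rfl

lemma regs_scratch {n v w a b z : ℕ} : ∀ i ≥ rT, regs n v w a b z i = 0 := by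
  intro i hi
  fin_cases i <;> first | rfl | exact absurd hi (by decide)

end regs

/-- The searched register `rZ` may be any of the three arguments: the last in the search for a
successor, the first in the search for a predecessor. -/
lemma runs_search_regs (hx : IsMatrixWord x n A) (hs : n.size + 2 ≤ s) {v w a b z : ℕ}
    {i j l : Fin 10} (K : ℕ) (hi : i < rT) (hj : j < rT) (hl : l < rT) (hz : z ≤ n) (hK : K ≤ n)
    (hn : ∀ t < n, regs n v w a b t i < n ∧ regs n v w a b t j < n ∧ regs n v w a b t l < n)
    (hT : ∀ t < K, followedBy A (regs n v w a b t i) (regs n v w a b t j)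
      (regs n v w a b t l) = false)
    (hT' : K < n → followedBy A (regs n v w a b K i) (regs n v w a b K j)
      (regs n v w a b K l) = true) :
    (search rZ rN (followed i j l)).Runs x s (.registers 0 (regs n v w a b z) o) true
      (.registers 0 (regs n v w a b K) o) := by
  have h := runs_search (x := x) (z := rZ) (N := rN) (T := followed i j l) (K := K)
    (ρ := regs n v w a b z) (o := o) (p := 0) hs (by omega) (by decide) rfl hz hK
  simp only [update_regs_Z] at h
  refine h (fun t ht => ?_) fun hKn => ?_
  · rw [← hT t ht]
    obtain ⟨h₁, h₂, h₃⟩ := hn t (by omega)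
    exact runs_followed hx hs hi hj hl regs_scratch h₁ h₂ h₃
  · rw [← hT' hKn]
    obtain ⟨h₁, h₂, h₃⟩ := hn K hKn
    exact runs_followed hx hs hi hj hl regs_scratch h₁ h₂ h₃

/-- A failed search leaves `n` in `rZ`; copied to `rY`, it ends the loop. The content `a'` of `rX`
is then irrelevant, only bounded so that it can be cleared. -/
lemma runs_writeTrace (hx : IsMatrixWord x n A) (hs : n.size + 2 ≤ s) {v w : ℕ} {a b : Fin n}
    {l : List (Fin n)} (h : IsTrace A a b l) {z : ℕ} (hz : z ≤ n) (o : List PathSymbol) :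
    ∃ a' ≤ n, writeTrace.Runs x s (.registers 0 (regs n v w a b z) o) true
      (.registers 0 (regs n v w a' n n) (o ++ l.flatMap encodeVertex)) := by
  have htest (a b z : ℕ) (o : List PathSymbol) (hb : b ≤ n) : (not (equal rY rN)).Runs x s
      (.registers 0 (regs n v w a b z) o) (!decide (b = n))
      (.registers 0 (regs n v w a b z) o) :=
    (runs_equal (ρ := regs n v w a b z) (r := rY) (r' := rN) hs (by omega) (by decide) hb
      le_rfl).not
  have hbody (a b : Fin n) (z K : ℕ) (o : List PathSymbol) (hz : z ≤ n) (hK : K ≤ n)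
      (hT : ∀ t < K, followedBy A a b t = false) (hT' : K < n → followedBy A a b K = true) :
      (seq (emitRegister rY) <| seq (search rZ rN (followed rX rY rZ)) <|
        seq (copy rY rX) (copy rZ rY) : GraphFragment).Runs x s
      (.registers 0 (regs n v w a b z) o) true
      (.registers 0 (regs n v w b K K) (o ++ encodeVertex b)) := by
    have h₀ : (search rZ rN (followed rX rY rZ)).Runs x s
        (.registers 0 (regs n v w a b z) (o ++ encodeVertex b)) true
        (.registers 0 (regs n v w a b K) (o ++ encodeVertex b)) :=
      runs_search_regs hx hs K (by decide) (by decide) (by decide) hz hK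
        (fun t ht => ⟨a.2, b.2, ht⟩) hT hT'
    have h₁ := runs_copy (x := x) (n := n) (p := 0) (a := rY) (b := rX) (ρ := regs n v w a b K)
      (o := o ++ encodeVertex b) hs (by omega) (by decide) b.2.le a.2.le
    have h₂ := runs_copy (x := x) (n := n) (p := 0) (a := rZ) (b := rY) (ρ := regs n v w b b K)
      (o := o ++ encodeVertex b) hs (by omega) (by decide) hK b.2.le
    rw [update_regs_X] at h₁
    rw [update_regs_Y] at h₂
    exact (runs_emitRegister (n := n) (r := rY) hs (by omega) b.2.le).seq <|
      h₀.seq <| h₁.seq h₂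
  induction h generalizing z o with
  | @last a b hT =>
    refine ⟨b, b.2.le, ?_⟩
    have h₁ := htest a b z o b.2.le
    have h₂ := htest b n n (o ++ encodeVertex b) le_rfl
    rw [decide_eq_false b.2.ne] at h₁
    rw [decide_eq_true rfl] at h₂
    rw [List.flatMap_singleton]
    exact h₁.loop_true (hbody a b z n o hz le_rfl hT (by simp)) h₂.loop_false
  | @cons a b c l hT hT' _ ih =>
    obtain ⟨a', ha', h⟩ := ih c.2.le (o ++ encodeVertex b)
    refine ⟨a', ha', ?_⟩
    have h₁ := htest a b z o b.2.le
    rw [decide_eq_false b.2.ne] at h₁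
    rw [List.flatMap_cons, ← List.append_assoc]
    exact h₁.loop_true (hbody a b z c o hz c.2.le hT fun _ => hT') h

/-- The search for a predecessor of `(v, w)` yields `n` iff there is none, and only then is a path
written. -/
lemma runs_writePath (hx : IsMatrixWord x n A) (hs : n.size + 2 ≤ s) {v w : Fin n}
    {e : List PathSymbol}
    (he : A v w = true → (∀ u < n, followedBy A u v w = false) →
      ∃ l, IsTrace A v w l ∧ e = (v :: l).flatMap encodeVertex ++ [.endPath])
    (he' : ¬ (A v w = true ∧ ∀ u < n, followedBy A u v w = false) → e = []) :
    writePath.Runs x s (.registers 0 (regs n v w 0 0 0) o) true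
      (.registers 0 (regs n v w 0 0 0) (o ++ e)) := by
  have h₁ := runs_adjacent (ρ := regs n v w 0 0 0) (o := o) (a := rV) (b := rW) hx hs (by decide)
    (by decide) rfl v.2 w.2
  change (adjacent rV rW).Runs x s _ (A v w) _ at h₁
  cases hA : A v w
  · rw [he' (by simp [hA]), List.append_nil]
    rw [hA] at h₁
    exact h₁.when_false
  rw [hA] at h₁
  refine h₁.when_true ?_
  have hsearch (K : ℕ) (hK : K ≤ n) (hT : ∀ t < K, followedBy A t v w = false)
      (hT' : K < n → followedBy A K v w = true) :
      (search rZ rN (followed rZ rV rW)).Runs x s (.registers 0 (regs n v w 0 0 0) o) true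
      (.registers 0 (regs n v w 0 0 K) o) :=
    runs_search_regs hx hs K (by decide) (by decide) (by decide) (Nat.zero_le _) hK
      (fun t ht => ⟨ht, v.2, w.2⟩) hT hT'
  have hequal (K : ℕ) (hK : K ≤ n) : (equal rZ rN).Runs x s (.registers 0 (regs n v w 0 0 K) o)
      (K = n) (.registers 0 (regs n v w 0 0 K) o) :=
    runs_equal (ρ := regs n v w 0 0 K) (r := rZ) (r' := rN) hs (by omega) (by decide) hK le_rfl
  have hclear (K : ℕ) (hK : K ≤ n) (o : List PathSymbol) : (clear rZ).Runs x s
      (.registers 0 (regs n v w 0 0 K) o) true (.registers 0 (regs n v w 0 0 0) o) := by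
    have := runs_clear (x := x) (n := n) (p := 0) (r := rZ) (ρ := regs n v w 0 0 K) (o := o) hs
      (by omega) hK
    rwa [update_regs_Z] at this
  by_cases hu : ∀ u < n, followedBy A u v w = false
  · obtain ⟨l, hl, rfl⟩ := he hA hu
    refine (hsearch n le_rfl hu (by simp)).seq (.seq (b := true) ?_ (hclear n le_rfl _))
    have h₂ := hequal n le_rfl
    rw [decide_eq_true rfl] at h₂
    refine h₂.when_true <| (runs_emitRegister (n := n) (r := rV) hs (by omega) v.2.le).seq ?_
    have h₃ := runs_copy (x := x) (n := n) (p := 0) (a := rV) (b := rX) (ρ := regs n v w 0 0 n)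
      (o := o ++ encodeVertex v) hs (by omega) (by decide) v.2.le (Nat.zero_le _)
    have h₄ := runs_copy (x := x) (n := n) (p := 0) (a := rW) (b := rY) (ρ := regs n v w v 0 n)
      (o := o ++ encodeVertex v) hs (by omega) (by decide) w.2.le (Nat.zero_le _)
    rw [update_regs_X] at h₃
    rw [update_regs_Y] at h₄
    obtain ⟨a, ha, h₅⟩ := runs_writeTrace hx hs (v := v) (w := w) hl le_rfl (o ++ encodeVertex v)
    have h₆ := runs_emitSymbol (x := x) (s := s) (p := 0) (ρ := regs n v w a n n)
      (o := o ++ encodeVertex v ++ l.flatMap encodeVertex) (e := .endPath) (by omega) (by omega)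
    have h₇ := runs_clear (x := x) (n := n) (p := 0) (r := rX) (ρ := regs n v w a n n)
      (o := o ++ ((v :: l).flatMap encodeVertex ++ [.endPath])) hs (by omega) ha
    have h₈ := runs_clear (x := x) (n := n) (p := 0) (r := rY) (ρ := regs n v w 0 n n)
      (o := o ++ ((v :: l).flatMap encodeVertex ++ [.endPath])) hs (by omega) le_rfl
    rw [update_regs_X] at h₇
    rw [update_regs_Y] at h₈
    refine h₃.seq <| h₄.seq <| h₅.seq <| h₆.seq ?_
    simpa using h₇.seq h₈
  · rw [he' (fun h => hu h.2), List.append_nil]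
    push Not at hu
    have hu' : ∃ u, u < n ∧ followedBy A u v w = true := by simpa using hu
    classical
    have hK := Nat.find_spec hu'
    refine (hsearch (Nat.find hu') hK.1.le (fun t ht => ?_) fun _ => hK.2).seq
      (.seq (b := true) ?_ (hclear _ hK.1.le _))
    · have := Nat.find_min hu' ht
      simpa [ht.trans hK.1] using this
    · have h₂ := hequal _ hK.1.le
      rw [decide_eq_false hK.1.ne] at h₂
      exact h₂.when_false

lemma runs_readSize (hx : IsMatrixWord x n A) (hs : n.size + 2 ≤ s) :
    readSize.Runs x s (.registers 0 (regs 0 0 0 0 0 0) o) true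
      (.registers 0 (regs n 0 0 0 0 0) o) := by
  have hlen : n ≤ x.length := by
    rw [hx.length_eq]
    nlinarith
  refine (runs_moveInput (p' := 1) (by omega) (by omega) (by omega) rfl).seq <|
    .seq (b := true) (m₁ := .registers (n + 1) (regs n 0 0 0 0 0) o)
      (runs_loop (fun i => .registers (i + 1) (regs i 0 0 0 0 0) o) n (fun i hi => ?_)
        (fun i hi => ?_) ?_) (runs_rewindInput (by omega) (by omega))
  · have := hx.bit (show 0 < n by omega) hi
    rw [zero_mul, zero_add] at this
    exact runs_inputTest (by omega) (by omega) (by simp [Transducer.inputCell, this, isBit])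
  · refine (runs_moveInput (p' := i + 1 + 1) (by omega) (by omega) (by omega) rfl).seq ?_
    have := runs_increment (x := x) (p := i + 1 + 1) (r := rN) (ρ := regs i 0 0 0 0 0) (o := o) hs
      (by omega) hi.le
    rwa [update_regs_N] at this
  · refine runs_inputTest (by omega) (by omega) ?_
    -- For `n = 0` the input is empty and the scan stops at the right end marker instead of an
    -- end-of-row symbol.
    rcases Nat.eq_zero_or_pos n with rfl | hn
    · have := hx.length_eq
      simp only [zero_mul, List.length_eq_zero_iff] at this
      simp [this, Transducer.inputCell, isBit]
    · have := hx.endRow hn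
      rw [zero_mul, zero_add] at this
      simp [Transducer.inputCell, this, isBit]

/-- If `e v w` is the encoding of the path that starts with the arc `(v, w)` whenever `(v, w)` does
not follow another arc, then the fragment writes all these encodings. -/
lemma runs_writePaths (hx : IsMatrixWord x n A) (hs : n.size + 2 ≤ s)
    {e : Fin n → Fin n → List PathSymbol}
    (he : ∀ v w : Fin n, A v w = true → (∀ u < n, followedBy A u v w = false) →
      ∃ l, IsTrace A v w l ∧ e v w = (v :: l).flatMap encodeVertex ++ [.endPath])
    (he' : ∀ v w : Fin n, ¬ (A v w = true ∧ ∀ u < n, followedBy A u v w = false) → e v w = []) :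
    writePaths.Runs x s (.init none) true (.registers 0 (regs n 0 0 0 0 0)
      ((List.finRange n).flatMap fun v => (List.finRange n).flatMap (e v))) := by
  have hinit : (fun _ => 0) = regs 0 0 0 0 0 0 := by funext j; fin_cases j <;> rfl
  have htake (f : Fin n → List PathSymbol) (i : Fin n) :
      ((List.finRange n).take (i + 1)).flatMap f =
        ((List.finRange n).take i).flatMap f ++ f i := by
    rw [List.take_succ_eq_append_getElem (by simp)]
    simp
  have hall (f : Fin n → List PathSymbol) :
      ((List.finRange n).take n).flatMap f = (List.finRange n).flatMap f := by
    rw [List.take_of_length_le (by simp)]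
  have hinner (v : Fin n) (o : List PathSymbol) : (forLoop rW rN writePath).Runs x s
      (.registers 0 (regs n v 0 0 0 0) o) true
      (.registers 0 (regs n v 0 0 0 0) (o ++ (List.finRange n).flatMap (e v))) := by
    have := runs_forLoop (x := x) (t := rW) (a := rN) (B := writePath)
      (fun _ => regs n v 0 0 0 0) (fun _ => 0)
      (fun i => o ++ ((List.finRange n).take i).flatMap (e v)) hs le_rfl (by decide)
      (fun _ _ => rfl) (fun _ _ => by omega) (fun i hi => by
        simp only [update_regs_W]
        rw [htake (e v) ⟨i, hi⟩, ← List.append_assoc]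
        exact runs_writePath (w := ⟨i, hi⟩) hx hs (he v ⟨i, hi⟩) (he' v ⟨i, hi⟩))
    simpa only [update_regs_W, hall, List.take_zero, List.flatMap_nil, List.append_nil] using this
  have houter := runs_forLoop (x := x) (t := rV) (a := rN) (B := forLoop rW rN writePath)
      (fun _ => regs n 0 0 0 0 0) (fun _ => 0)
      (fun i => ((List.finRange n).take i).flatMap fun v => (List.finRange n).flatMap (e v)) hs
      le_rfl (by decide) (fun _ _ => rfl) (fun _ _ => by omega) (fun i hi => by
        simp only [update_regs_V]
        rw [htake _ ⟨i, hi⟩]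
        exact hinner ⟨i, hi⟩ _)
  simp only [update_regs_V, hall, List.take_zero, List.flatMap_nil] at houter
  have h := runs_markTapes (α := GraphSymbol) (β := PathSymbol) (k := 10) (x := x) (s := s)
    (by omega)
  rw [hinit] at h
  exact h.seq <| (runs_readSize hx hs).seq houter

end

end Fragment

/-! ### Path decompositions -/

namespace Digraph

/-! ### The lower bound for the number of paths -/

section LowerBound

variable {V : Type*} {G : Digraph V}

/-- A simple path leaves each vertex at most once; hence distinct out-arcs of a vertex lie on
distinct paths. -/
lemma infix_right_unique {p : List V} (hp : p.Nodup) {u v w : V} (hv : [u, v] <:+: p)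
    (hw : [u, w] <:+: p) : v = w := by
  induction p with
  | nil => simp at hv
  | cons a p ih =>
    rw [List.nodup_cons] at hp
    rw [List.infix_cons_iff, List.cons_prefix_cons] at hv hw
    have hmem {x : V} (h : [u, x] <:+: p) : u ∈ p := h.subset (by simp)
    rcases hv with ⟨rfl, hv⟩ | hv <;> rcases hw with ⟨h, hw⟩ | hw
    · obtain ⟨s, rfl⟩ := hv
      simpa [eq_comm] using hw
    · exact absurd (hmem hw) hp.1
    · exact absurd (h ▸ hmem hv) hp.1
    · exact ih hp.2 hv hw

lemma head_or_exists_infix {p : List V} {u v : V} (h : [u, v] <:+: p) :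
    p.head? = some u ∨ ∃ t, [t, u] <:+: p := by
  obtain ⟨s, t, rfl⟩ := h
  rcases s.eq_nil_or_concat with rfl | ⟨s, a, rfl⟩
  · simp
  · exact .inr ⟨a, s, v :: t, by simp⟩

lemma adj_of_infix {p : List V} (hp : p.IsChain G.Adj) {u v : V} (h : [u, v] <:+: p) :
    G.Adj u v := by
  simpa using hp.infix h

-- Every path has one first vertex, so the numbers of paths starting at the single vertices add up
-- to at most the length. It remains to bound each of them from below by the excess of out-arcs over
-- in-arcs.
open Classical in
lemma IsPathDecomposition.sum_le_length [Fintype V] {Q : List (List V)}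
    (hQ : G.IsPathDecomposition Q) :
    ∑ v, max 0 ((G.outdegree v : ℤ) - (G.indegree v : ℤ)) ≤ Q.length := by
  let S (v : V) : Finset (Fin Q.length) := Finset.univ.filter fun i => Q[i].head? = some v
  have hS : ∑ v, (S v).card ≤ Q.length := by
    rw [← Finset.card_biUnion]
    · exact (Finset.card_le_univ _).trans (by simp)
    · intro v _ w _ hvw
      rw [Function.onFun, Finset.disjoint_left]
      intro i hv hw
      simp only [S, Finset.mem_filter] at hv hw
      exact hvw (Option.some.inj (hv.2.symm.trans hw.2))
  have hS' : ∑ v, ((S v).card : ℤ) ≤ Q.length := by exact_mod_cast hS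
  refine le_trans (Finset.sum_le_sum fun v _ => ?_) hS'
  suffices H : G.outdegree v ≤ G.indegree v + (S v).card by omega
  -- `f u v` is the index of the only path through the arc `(u, v)`.
  choose f hf hf' using hQ.2
  let O : Finset V := Finset.univ.filter (G.Adj v)
  let I : Finset V := Finset.univ.filter fun u => G.Adj u v
  have hO : G.outdegree v = O.card := by
    rw [outdegree, ← Set.ncard_coe_finset]
    congr 1
    ext; simp [O]
  have hI : G.indegree v = I.card := by
    rw [indegree, ← Set.ncard_coe_finset]
    congr 1
    ext; simp [I]
  have hOi : O.attach.card = (O.attach.image fun w =>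
      f v w.1 (Finset.mem_filter.1 w.2).2).card := by
    rw [Finset.card_image_of_injective]
    intro w w' hww
    have hw := hf v w.1 (Finset.mem_filter.1 w.2).2
    have hw' := hf v w'.1 (Finset.mem_filter.1 w'.2).2
    dsimp only at hww hw hw'
    rw [← hww] at hw'
    exact Subtype.ext (infix_right_unique (hQ.1 _ (List.getElem_mem _)).2.2 hw hw')
  rw [hO, hI, ← O.card_attach, hOi, ← I.card_attach]
  refine le_trans (Finset.card_le_card (t := (I.attach.image fun u =>
    f u.1 v (by simpa only [I, Finset.mem_filter, Finset.mem_univ, true_and] using u.2)) ∪ S v) ?_) ((Finset.card_union_le _ _).trans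
      (Nat.add_le_add_right Finset.card_image_le _))
  -- A path through an out-arc of `v` starts at `v`, or enters `v` by an in-arc and is by uniqueness
  -- the path `f` assigns to that arc.
  intro i hi
  obtain ⟨w, -, rfl⟩ := Finset.mem_image.1 hi
  have hw := hf v w.1 (Finset.mem_filter.1 w.2).2
  rcases head_or_exists_infix hw with h | ⟨t, ht⟩
  · exact Finset.mem_union_right _ (by simpa [S] using h)
  · have hadj : G.Adj t v := adj_of_infix (hQ.1 _ (List.getElem_mem _)).2.1 ht
    refine Finset.mem_union_left _ (Finset.mem_image.2 ⟨⟨t, by simpa [I] using hadj⟩,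
      Finset.mem_attach _ _, (hf' t v hadj _ ht).symm⟩)

end LowerBound

/-! ### Well-foundedness and simple walks in acyclic digraphs -/

section Acyclic

variable {V : Type*} {G : Digraph V}

lemma IsAcyclic.wellFounded [Finite V] (hG : G.IsAcyclic) : WellFounded G.Adj :=
  have : Std.Irrefl (Relation.TransGen G.Adj) := ⟨hG⟩
  (Finite.wellFounded_of_trans_of_irrefl (Relation.TransGen G.Adj)).mono fun _ _ h => .single h

lemma IsAcyclic.wellFounded_flip [Finite V] (hG : G.IsAcyclic) :
    WellFounded fun u v => G.Adj v u :=
  have : Std.Irrefl (Function.swap (Relation.TransGen G.Adj)) := ⟨hG⟩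
  (Finite.wellFounded_of_trans_of_irrefl (Function.swap (Relation.TransGen G.Adj))).mono
    fun _ _ h => Relation.TransGen.single h

/-- Any two positions of the chain are joined by a directed walk; a repeated vertex would close it.
-/
lemma IsAcyclic.nodup_of_isChain (hG : G.IsAcyclic) {p : List V} (hp : p.IsChain G.Adj) :
    p.Nodup := by
  have h := (hp.imp fun _ _ => Relation.TransGen.single).pairwise
  exact h.imp fun {a b} hab => by
    rintro rfl
    exact hG a hab

end Acyclic

/-! #### The decomposition found by the algorithm -/

variable {n : ℕ} (G : Digraph (Fin n))

open Classical in
/-- The adjacency matrix of a digraph. -/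
noncomputable def matrix (u v : ℕ) : Bool :=
  decide (∃ (hu : u < n) (hv : v < n), G.Adj ⟨u, hu⟩ ⟨v, hv⟩)

lemma matrix_eq_true {u v : Fin n} : G.matrix u v = true ↔ G.Adj u v := by simp [matrix]

lemma getElem?_flatMap {α β : Type*} (l : List α) (f : α → List β) {m : ℕ}
    (hf : ∀ a ∈ l, (f a).length = m) {i j : ℕ} (hi : i < l.length) (hj : j < m) :
    (l.flatMap f)[i * m + j]? = (f l[i])[j]? := by
  induction l generalizing i with
  | nil => simp at hi
  | cons a l ih =>
    have ha := hf a (by simp)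
    rw [List.flatMap_cons]
    rcases i with _ | i
    · rw [zero_mul, zero_add, List.getElem?_append_left (by omega)]
      simp
    · rw [List.getElem?_append_right (by rw [ha]; nlinarith), ha,
        show (i + 1) * m + j - m = i * m + j by rw [Nat.succ_mul]; omega,
        ih (fun a h => hf a (by simp [h])) (by simpa using hi)]
      simp

lemma isMatrixWord_encodeDigraph : IsMatrixWord (encodeDigraph G) n G.matrix where
  length_eq := by simp [encodeDigraph, List.length_flatMap]
  bit {u v} hu hv := by
    classical
    rw [encodeDigraph, getElem?_flatMap _ _ (by simp) (by simpa using hu) (by omega),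
      List.getElem?_append_left (by simpa using hv)]
    simp [hv, hu, matrix]
  endRow {u} hu := by
    rw [encodeDigraph, getElem?_flatMap _ _ (by simp) (by simpa using hu) (by omega),
      List.getElem?_append_right (by simp)]
    simp

/-- The ranks of the elements below `m` run through `0, …, count - 1` without gaps. Applied to
in-neighbours, this says which out-arcs have a predecessor. -/
lemma exists_count_eq_iff (p : ℕ → Prop) [DecidablePred p] (m r : ℕ) :
    (∃ u < m, p u ∧ Nat.count p u = r) ↔ r < Nat.count p m := by
  induction m with
  | zero => simp
  | succ m ih =>
    rw [Nat.count_succ, Nat.exists_lt_succ_right, ih]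
    by_cases h : p m <;> simp [h] ; omega

/-- Ranks being consecutive, the condition discards the first `r` elements; truncated subtraction
covers the case that there are fewer. -/
lemma count_and_le_count (p : ℕ → Prop) [DecidablePred p] (m r : ℕ) :
    Nat.count (fun w => p w ∧ r ≤ Nat.count p w) m = Nat.count p m - r := by
  induction m with
  | zero => simp
  | succ m ih =>
    rw [Nat.count_succ, Nat.count_succ, ih]
    by_cases h : p m <;> simp only [h, true_and, false_and, if_true, if_false]
    · split_ifs <;> omega
    · omega

lemma card_filter_fin (p : ℕ → Prop) [DecidablePred p] :
    (Finset.univ.filter fun i : Fin n => p i).card = Nat.count p n := by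
  rw [Finset.card_filter, Fin.sum_univ_eq_sum_range (fun i => if p i then 1 else 0),
    ← Finset.card_filter, Nat.count_eq_card_filter_range]

lemma outdegree_eq_count (v : Fin n) : G.outdegree v = Nat.count (fun i => G.matrix v i) n := by
  rw [← card_filter_fin, ← Set.ncard_coe_finset, outdegree]
  congr 1
  ext; simp [matrix_eq_true]

lemma indegree_eq_count (v : Fin n) : G.indegree v = Nat.count (fun i => G.matrix i v) n := by
  rw [← card_filter_fin, ← Set.ncard_coe_finset, indegree]
  congr 1
  ext; simp [matrix_eq_true]

/-! ### Chains of arcs -/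

/-- The arc `e` is followed by the arc `e'`. -/
def Follows (e e' : Fin n × Fin n) : Prop := e.2 = e'.1 ∧ followedBy G.matrix e.1 e.2 e'.2 = true

/-- The arc `e` does not follow another one. -/
def IsFirst (e : Fin n × Fin n) : Prop :=
  G.matrix e.1 e.2 = true ∧ ∀ u < n, followedBy G.matrix u e.1 e.2 = false

variable {G}

lemma followedBy_iff {u v w : ℕ} : followedBy G.matrix u v w = true ↔ G.matrix u v = true ∧
    G.matrix v w = true ∧
      Nat.count (fun i => G.matrix i v) u = Nat.count (fun i => G.matrix v i) w := by
  simp [followedBy]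

/-- Among the in-neighbours of `v`, the rank determines the vertex. Likewise for out-neighbours in
the next lemma, so the pairing at `v` is a partial bijection. -/
lemma followedBy_left_unique {u u' v w : ℕ} (h : followedBy G.matrix u v w = true)
    (h' : followedBy G.matrix u' v w = true) : u = u' := by
  rw [followedBy_iff] at h h'
  exact Nat.count_injective (p := fun i => G.matrix i v) h.1 h'.1 (h.2.2.trans h'.2.2.symm)

lemma followedBy_right_unique {u v w w' : ℕ} (h : followedBy G.matrix u v w = true)
    (h' : followedBy G.matrix u v w' = true) : w = w' := by
  rw [followedBy_iff] at h h'
  exact Nat.count_injective (p := fun i => G.matrix v i) h.2.1 h'.2.1 (h.2.2.symm.trans h'.2.2)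

/-- A predecessor of `(v, w)` is an in-neighbour of `v` of the same rank as `w`, and the ranks of
in-neighbours are exactly the numbers below the indegree. -/
lemma isFirst_iff {v w : Fin n} : G.IsFirst (v, w) ↔
    G.matrix v w = true ∧ G.indegree v ≤ Nat.count (fun i => G.matrix v i) w := by
  refine and_congr_right fun h => ?_
  rw [indegree_eq_count, ← not_lt, ← exists_count_eq_iff]
  push Not
  refine forall₂_congr fun u _ => ?_
  rw [← Bool.not_eq_true, followedBy_iff]
  simp [h]

open Classical in
lemma card_isFirst : ((Finset.univ.filter G.IsFirst).card : ℤ) =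
    ∑ v, max 0 ((G.outdegree v : ℤ) - (G.indegree v : ℤ)) := by
  rw [Finset.card_filter, Fintype.sum_prod_type]
  push_cast
  refine Finset.sum_congr rfl fun v _ => ?_
  have h := count_and_le_count (fun i => G.matrix v i) n (G.indegree v)
  rw [← outdegree_eq_count, ← card_filter_fin, Finset.card_filter] at h
  have h' : (∑ w, if G.IsFirst (v, w) then 1 else 0) = G.outdegree v - G.indegree v := by
    simpa only [isFirst_iff] using h
  have h'' := congrArg (Nat.cast : ℕ → ℤ) h'
  push_cast at h''
  rw [h'']
  omega

/-- Each step moves the head of the arc forward, so the walk ends. The pair `(u, v)` need not be an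
arc, which allows a trace to be chosen for all pairs at once. -/
lemma IsAcyclic.exists_isTrace (hG : G.IsAcyclic) (v : Fin n) :
    ∀ u, ∃ l, IsTrace G.matrix u v l := by
  induction v using hG.wellFounded_flip.induction with
  | _ v ih =>
    intro u
    by_cases h : ∀ w < n, followedBy G.matrix u v w = false
    · exact ⟨_, .last h⟩
    · push Not at h
      obtain ⟨w, hw, h⟩ := h
      rw [ne_eq, Bool.not_eq_false] at h
      obtain ⟨l, hl⟩ := ih ⟨w, hw⟩ (matrix_eq_true G |>.1 (followedBy_iff.1 h).2.1) v
      -- A trace proceeds to the least follower, as the search does; by uniqueness there is no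
      -- other.
      refine ⟨_, .cons (fun i hi => ?_) h hl⟩
      rw [← Bool.not_eq_true]
      intro h'
      exact hi.ne (followedBy_right_unique h' h)

lemma isChain_of_isTrace {u v : Fin n} {l : List (Fin n)} (h : IsTrace G.matrix u v l)
    (huv : G.Adj u v) : (u :: l).IsChain G.Adj := by
  induction h with
  | last _ => simpa using huv
  | cons _ h' _ ih =>
    exact .cons_cons huv (ih (G.matrix_eq_true.1 (followedBy_iff.1 h').2.1))

/-- This turns membership of an arc in a written path into reachability along `Follows`, for which
existence and uniqueness of the origin are shown next. -/
lemma infix_iff_of_isTrace {a b : Fin n} {l : List (Fin n)} (h : IsTrace G.matrix a b l)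
    {u v : Fin n} : [u, v] <:+: a :: l ↔ Relation.ReflTransGen G.Follows (a, b) (u, v) := by
  induction h with
  | @last a b h =>
    rw [Relation.ReflTransGen.cases_head_iff]
    have hno : ¬ ∃ c, G.Follows (a, b) c ∧ Relation.ReflTransGen G.Follows c (u, v) := by
      rintro ⟨c, hc, -⟩
      simpa [h c.2 c.2.2] using hc.2
    simp only [hno, or_false, Prod.mk.injEq, List.infix_cons_iff]
    simp [eq_comm (a := u), eq_comm (a := v)]
  | @cons a b c l _ h' _ ih =>
    rw [Relation.ReflTransGen.cases_head_iff, List.infix_cons_iff, ih]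
    refine or_congr (by simp [eq_comm]) ⟨fun h => ⟨_, ⟨rfl, h'⟩, h⟩, ?_⟩
    rintro ⟨⟨b', c'⟩, ⟨rfl, h''⟩, h⟩
    obtain rfl := Fin.ext (followedBy_right_unique h' h'')
    exact h

/-- Passing to predecessors moves the tail backwards along arcs, which must stop in a finite acyclic
digraph. -/
lemma IsAcyclic.exists_isFirst (hG : G.IsAcyclic) (u : Fin n) :
    ∀ v, G.Adj u v → ∃ e, G.IsFirst e ∧ Relation.ReflTransGen G.Follows e (u, v) := by
  induction u using hG.wellFounded.induction with
  | _ u ih =>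
    intro v huv
    by_cases h : ∀ t < n, followedBy G.matrix t u v = false
    · exact ⟨(u, v), ⟨G.matrix_eq_true.2 huv, h⟩, .refl⟩
    · push Not at h
      obtain ⟨t, ht, h⟩ := h
      rw [ne_eq, Bool.not_eq_false] at h
      obtain ⟨e, he, hu⟩ := ih ⟨t, ht⟩ (G.matrix_eq_true.1 (followedBy_iff.1 h).1) u
        (G.matrix_eq_true.1 (followedBy_iff.1 h).1)
      exact ⟨e, he, hu.tail ⟨rfl, h⟩⟩

/-- Predecessors are unique, so two arcs from which `f` is reached are comparable along `Follows`;
but nothing precedes a first arc. -/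
lemma isFirst_unique {e e' f : Fin n × Fin n} (he : G.IsFirst e) (he' : G.IsFirst e')
    (h : Relation.ReflTransGen G.Follows e f) (h' : Relation.ReflTransGen G.Follows e' f) :
    e = e' := by
  have hroot {e e' : Fin n × Fin n} (he' : G.IsFirst e')
      (h : Relation.ReflTransGen G.Follows e e') : e = e' := by
    rcases h.cases_tail with h | ⟨c, -, hc⟩
    · exact h.symm
    · have := he'.2 c.1 c.1.2
      rw [← hc.1, hc.2] at this
      cases this
  have hU : Relator.RightUnique (Function.swap G.Follows) := by
    rintro ⟨a, b⟩ ⟨c, d⟩ ⟨c', d'⟩ ⟨h₁, h₂⟩ ⟨h₃, h₄⟩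
    dsimp only at h₁ h₂ h₃ h₄
    subst h₁ h₃
    rw [Fin.ext (followedBy_left_unique h₂ h₄)]
  rcases Relation.ReflTransGen.total_of_right_unique hU (Relation.reflTransGen_swap.2 h)
    (Relation.reflTransGen_swap.2 h') with h | h
  · exact (hroot he (Relation.reflTransGen_swap.1 h)).symm
  · exact hroot he' (Relation.reflTransGen_swap.1 h)

end Digraph

/-! ### The written paths form a minimal decomposition -/

namespace Digraph

variable {n : ℕ} {G : Digraph (Fin n)}

/-- If `l` lists the first arcs and `tr e` is the trace of the arc `e`, then the paths `e.1 :: tr e`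
form a path decomposition. -/
lemma IsAcyclic.isPathDecomposition_map (hG : G.IsAcyclic) {l : List (Fin n × Fin n)}
    (hl : l.Nodup) (hl' : ∀ e, e ∈ l ↔ G.IsFirst e) {tr : Fin n × Fin n → List (Fin n)}
    (htr : ∀ e, IsTrace G.matrix e.1 e.2 (tr e)) :
    G.IsPathDecomposition (l.map fun e => e.1 :: tr e) := by
  refine ⟨fun p hp => ?_, fun u v huv => ?_⟩
  · obtain ⟨e, he, rfl⟩ := List.mem_map.1 hp
    have hc := isChain_of_isTrace (htr e) (G.matrix_eq_true.1 ((hl' e).1 he).1)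
    exact ⟨List.cons_ne_nil _ _, hc, hG.nodup_of_isChain hc⟩
  · obtain ⟨e, he, heu⟩ := hG.exists_isFirst u v huv
    obtain ⟨i, hi, rfl⟩ := List.getElem_of_mem ((hl' e).2 he)
    refine ⟨⟨i, by simpa using hi⟩, ?_, fun ⟨j, hj⟩ hj' => ?_⟩
    · simpa [infix_iff_of_isTrace (htr _)] using heu
    · have hj₀ : j < l.length := by simpa using hj
      simp only [Fin.getElem_fin, List.getElem_map, infix_iff_of_isTrace (htr _)] at hj'
      have := isFirst_unique ((hl' _).1 (List.getElem_mem hj₀)) he hj' heu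
      exact Fin.ext ((hl.getElem_inj_iff).1 this)

lemma flatMap_filter {α β : Type*} (l : List α) (p : α → Bool) (f : α → List β) :
    (l.filter p).flatMap f = l.flatMap fun a => if p a then f a else [] := by
  induction l with
  | nil => rfl
  | cons a l ih =>
    cases h : p a <;> simp [h, ih]

-- The first arcs are listed in lexicographic order, the order in which the nested loops meet them.
-- Minimality holds because their number equals the lower bound.
open Classical in
lemma IsAcyclic.exists_runs_writePaths (hG : G.IsAcyclic) {s : ℕ} (hs : n.size + 2 ≤ s) :
    ∃ P : List (List (Fin n)), G.IsMinimalPathDecomposition P ∧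
      (P.length : ℤ) = ∑ v, max 0 ((G.outdegree v : ℤ) - (G.indegree v : ℤ)) ∧
      ∃ m, Fragment.writePaths.Runs (encodeDigraph G) s (.init none) true m ∧
        m.output = encodePaths P := by
  choose tr htr using fun e : Fin n × Fin n => hG.exists_isTrace e.2 e.1
  let l := (List.finRange n ×ˢ List.finRange n).filter fun e => G.IsFirst e
  have hl : l.Nodup := ((List.nodup_finRange n).product (List.nodup_finRange n)).filter _
  have hl' (e) : e ∈ l ↔ G.IsFirst e := by
    have : e ∈ List.finRange n ×ˢ List.finRange n :=
      List.pair_mem_product.2 ⟨List.mem_finRange _, List.mem_finRange _⟩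
    simp [l, this]
  have hP := hG.isPathDecomposition_map hl hl' htr
  have hlen : ((l.map fun e => e.1 :: tr e).length : ℤ) =
      ∑ v, max 0 ((G.outdegree v : ℤ) - (G.indegree v : ℤ)) := by
    rw [List.length_map, ← card_isFirst, ← List.toFinset_card_of_nodup hl]
    congr 2
    ext e
    simp [hl']
  refine ⟨_, ⟨hP, fun Q hQ => ?_⟩, hlen, _, Fragment.runs_writePaths
    G.isMatrixWord_encodeDigraph hs (e := fun v w => if G.IsFirst (v, w) then
      (v :: tr (v, w)).flatMap encodeVertex ++ [.endPath] else []) (fun v w h h' => ?_)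
      (fun v w h => if_neg h), ?_⟩
  · have := hQ.sum_le_length
    rw [← hlen] at this
    exact_mod_cast this
  · exact ⟨_, htr (v, w), if_pos ⟨h, h'⟩⟩
  · simp only [Memory.registers, encodePaths, List.flatMap_map, l, flatMap_filter]
    -- The product of lists unfolds to the same nested traversal as the two loops.
    change _ = ((List.finRange n).flatMap fun a => (List.finRange n).map (Prod.mk a)).flatMap _
    rw [List.flatMap_assoc]
    simp only [List.flatMap_map, decide_eq_true_eq]

end Digraph

theorem theorem2 :
    ∃ (M : Transducer GraphSymbol PathSymbol) (C : ℕ),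
      ∀ (n : ℕ) (G : Digraph (Fin n)), G.IsAcyclic →
        ∃ P : List (List (Fin n)),
          G.IsMinimalPathDecomposition P ∧
          (P.length : ℤ) = ∑ v, max 0 ((G.outdegree v : ℤ) - (G.indegree v : ℤ)) ∧
          M.ComputesInSpace (encodeDigraph G) (encodePaths P) (C * (Nat.log 2 n + 1)) := by
  refine ⟨Fragment.writePaths.toTransducer none, 3, fun n G hG => ?_⟩
  -- A number up to `n` has at most `Nat.log 2 n + 1` bits. The mark and the blank add two cells, so
  -- the factor `3` suffices, also for `n = 0`, where the logarithm is `0`.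
  have hs : n.size + 2 ≤ 3 * (Nat.log 2 n + 1) := by
    have : n.size ≤ Nat.log 2 n + 1 := Nat.size_le.2 (Nat.lt_pow_succ_log_self one_lt_two n)
    omega
  obtain ⟨P, hP, hlen, m, hm, hout⟩ := hG.exists_runs_writePaths hs
  exact ⟨P, hP, hlen, hout ▸ hm.computesInSpace⟩
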